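/- **Rank-one constructions.** Let $h_1\ge 1$, $r_j\ge 2$ and $s_j(i)\ge 0$ ($j\ge1$, $1\le i\le r_j$) be integers. A rank-one construction with these parameters consists of towers: for each $j$, disjoint half-intervals (floors) of equal length $E_j, TE_j,\dots,T^{h_j-1}E_j$ of the real line, with union $X_j$, where $T$ is the parallel translation of each floor except the top one onto the next floor. To pass from stage $j$ to stage $j+1$, $E_j$ is cut into $r_j$ half-intervals $E_j^1,\dots,E_j^{r_j}$ of equal length (numbered from left to right), $s_j(i)$ new disjoint half-intervals (spacers) of the same length are put over the column $X_{i,j}=\bigsqcup_{0\le m<h_j}T^mE_j^i$, and the resulting columns are stacked in the order $i=1,\dots,r_j$: $T^{h_j+s_j(i)}E_j^i=E_j^{i+1}$ for $i<r_j$, $E_{j+1}=E_j^1$ and $h_{j+1}=r_jh_j+s_j(1)+\dots+s_j(r_j)$. This defines on $X=\bigcup_jX_j$ an (almost everywhere) invertible transformation $T$ that preserves Lebesgue measure $\mu$ on $X$. The unitary operator $f\mapsto f\circ T$ of $L_2(X,\mu)$ is also denoted by $T$, and $T^{\otimes n}$ is its tensor power, that is, the operator $F\mapsto F\circ(T\times\dots\times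 T)$ on $L_2(X^n,\mu^{n})$. **Sidon constructions of class $C(\nu)$.** The construction is called Sidon if for all $j$ and all $m$ with $h_j<m\le h_{j+1}$ the set $T^mX_j\cap X_j$ is contained (mod $0$) in one of the columns $X_{i,j}$, $1\le i\le r_j$. For a real $\nu\ge0$, a Sidon construction is of class $C(\nu)$ if 1. there is a sequence of stages $j(k)\to\infty$ such that $\sum_k r_{j(k)}^{-\delta}<\infty$ for every $\delta>0$, and for all $k$: $r_j=r_{j(k)}$ for $j(k)\le j<j(k+1)$, and $j(k+1)-j(k)=\lfloor r_{j(k)}^{\nu}\rfloor$; 2. $r_j\to\infty$, and there is a sequence $\psi(j)\to+\infty$ such that for all $j$: $s_j(1)>\psi(j)h_j$, and $s_j(i+1)>\psi(j)s_j(i)$ for $1\le i<r_j$. **Spectrum.** A unitary operator $U$ has singular (absolutely continuous) spectrum if for every vector $f$ its spectral measure $\sigma_f$, i.e. the finite Borel measure on the circle $\mathbb T=\{|z|=1\}$ with $\int z^m\,d\sigma_f=\langle U^mf,f\rangle$ for all $m\in\mathbb Z$, is singular (absolutely continuous) with respect to Lebesgue measure on $\mathbb T$. **Theorem.** Let $\nu\ge0$,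 let $T$ be a Sidon rank-one automorphism of class $C(\nu)$, and let $n\ge1$ be an integer. If $\nu\ge 2n-2$, then $T^{\otimes n}$ has singular spectrum; if $\nu<2n-2$, then $T^{\otimes n}$ has absolutely continuous spectrum. -/

import Mathlib

open MeasureTheory Filter Topology Set

/-! Rank-one (cutting and stacking) constructions. Stages `j` and columns `i` are numbered from
`0`, so `s j i` is the number of spacers put over the `(i+1)`-st column of the `(j+1)`-st tower. -/

/-- Parameters of a rank-one construction: the height `h₁` of the first tower, the numbers `r j`
of columns into which the towers are cut, and the numbers `s j i` (`i < r j`) of spacers. -/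
structure RankOneParams where
  h₁ : ℕ
  h₁_pos : 0 < h₁
  r : ℕ → ℕ
  two_le_r : ∀ j, 2 ≤ r j
  s : ℕ → ℕ → ℕ

namespace RankOneParams

variable (P : RankOneParams)

/-- The height of the tower of stage `j`. -/
def height : ℕ → ℕ
  | 0 => P.h₁
  | j + 1 => height j * P.r j + ∑ i ∈ Finset.range (P.r j), P.s j i

/-- The number of the floor of the tower of stage `j + 1` which is the base of the `i`-th column
of the tower of stage `j`. -/
def colStart (j i : ℕ) : ℕ := i * P.height j + ∑ l ∈ Finset.range i, P.s j l

/-- The growth condition `h_j ≪ s_j(1) ≪ s_j(2) ≪ ⋯ ≪ s_j(r_j)`, where `a_j ≪ b_j` means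
`b_j > ψ(j) a_j` for a fixed sequence `ψ(j) → +∞`, together with `r_j → ∞`. -/
def FastSpacers : Prop :=
  (∃ ψ : ℕ → ℝ, Tendsto ψ atTop atTop ∧ ∀ j,
    ψ j * (P.height j : ℝ) < (P.s j 0 : ℝ) ∧
    ∀ i, i + 1 < P.r j → ψ j * (P.s j i : ℝ) < (P.s j (i + 1) : ℝ)) ∧
  Tendsto P.r atTop atTop

/-- The conditions on the numbers of columns that define the class `C(ν)`. -/
def ColumnGrowth (ν : ℝ) : Prop :=
  ∃ J : ℕ → ℕ, Tendsto J atTop atTop ∧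
    (∀ δ : ℝ, 0 < δ → Summable fun k => (P.r (J k) : ℝ) ^ (-δ)) ∧
    (∀ k j, J k ≤ j → j < J (k + 1) → P.r j = P.r (J k)) ∧
    (∀ k, J (k + 1) = J k + ⌊(P.r (J k) : ℝ) ^ ν⌋₊)

lemma height_pos (j : ℕ) : 0 < P.height j := by
  induction j with
  | zero => exact P.h₁_pos
  | succ j ih =>
    have := P.two_le_r j
    have : 0 < P.height j * P.r j := Nat.mul_pos ih (by omega)
    simp only [height]
    omega

lemma colStart_succ (j i : ℕ) :
    P.colStart j (i + 1) = P.colStart j i + P.height j + P.s j i := by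
  simp only [colStart, Finset.sum_range_succ]
  ring

lemma height_succ (j : ℕ) : P.height (j + 1) = P.colStart j (P.r j) := by
  simp only [height, colStart]
  ring

lemma colStart_mono (j : ℕ) : Monotone (P.colStart j) :=
  monotone_nat_of_le_succ fun i => by rw [colStart_succ]; omega

lemma colStart_add_lt {j i k : ℕ} (hi : i < P.r j) (hk : k < P.height j) :
    P.colStart j i + k < P.height (j + 1) := by
  have h1 := P.colStart_mono j (Nat.succ_le_of_lt hi)
  rw [Nat.succ_eq_add_one, colStart_succ] at h1
  rw [height_succ]
  omega

end RankOneParams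

/-- A rank-one construction: its parameters, together with the half-intervals used as the floors
of the towers. The `k`-th floor of the tower of stage `j` is `[left j k, left j k + width j)`; every
floor of a tower is cut into `r j` half-intervals of equal length, and the floors of the columns,
with the spacers over each column, are stacked in their order from the first column to the
last one. The spacers may be any half-intervals that make the floors of each tower disjoint. -/
structure RankOneConstruction extends RankOneParams where
  width₁ : ℝ
  width₁_pos : 0 < width₁
  left : ℕ → ℕ → ℝ
  left_succ : ∀ j k i, k < toRankOneParams.height j → i < r j →
    left (j + 1) (toRankOneParams.colStart j i + k) =
      left j k + i * (width₁ / ∏ l ∈ Finset.range (j + 1), (r l : ℝ))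
  disjoint_floor : ∀ j k k', k < toRankOneParams.height j → k' < toRankOneParams.height j →
    k ≠ k' →
    Disjoint
      (Ico (left j k) (left j k + width₁ / ∏ l ∈ Finset.range j, (r l : ℝ)))
      (Ico (left j k') (left j k' + width₁ / ∏ l ∈ Finset.range j, (r l : ℝ)))

namespace RankOneConstruction

variable (C : RankOneConstruction)

/-- The length of the floors of the tower of stage `j`. -/
noncomputable def width (j : ℕ) : ℝ := C.width₁ / ∏ l ∈ Finset.range j, (C.r l : ℝ)

/-- The `k`-th floor of the tower of stage `j`; the base is the floor with number `0`. -/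
def floor (j k : ℕ) : Set ℝ := Ico (C.left j k) (C.left j k + C.width j)

/-- The tower `X_j` of stage `j`. -/
def tower (j : ℕ) : Set ℝ := ⋃ k ∈ Finset.range (C.height j), C.floor j k

/-- The `i`-th column `X_{i,j}` of the tower of stage `j` (without the spacers over it). -/
def column (j i : ℕ) : Set ℝ :=
  ⋃ k ∈ Finset.range (C.height j), C.floor (j + 1) (C.colStart j i + k)

/-- The phase space, the union of all towers. -/
def space : Set ℝ := ⋃ j, C.tower j

/-- Lebesgue measure on the phase space. -/
noncomputable def μ : Measure ℝ := volume.restrict C.space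

instance : SigmaFinite C.μ := by unfold μ; infer_instance

open Classical in
/-- The rank-one transformation: on each floor that is not the top floor of its tower, it is the
translation onto the next floor. (It is the identity on the remaining null set.) -/
noncomputable def T (x : ℝ) : ℝ :=
  if h : ∃ p : ℕ × ℕ, p.2 + 1 < C.height p.1 ∧ x ∈ C.floor p.1 p.2 then
    x + (C.left h.choose.1 (h.choose.2 + 1) - C.left h.choose.1 h.choose.2)
  else x

lemma width_pos (j : ℕ) : 0 < C.width j :=
  div_pos C.width₁_pos (Finset.prod_pos fun l _ => by
    have := C.two_le_r l
    exact_mod_cast (by omega : 0 < C.r l))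

lemma r_pos (j : ℕ) : (0 : ℝ) < C.r j := by
  have := C.two_le_r j
  exact_mod_cast (by omega : 0 < C.r j)

lemma width_eq (j : ℕ) : C.width j = C.r j * C.width (j + 1) := by
  have := C.r_pos j
  simp only [width, Finset.prod_range_succ]
  field_simp

lemma width_le (j : ℕ) : C.width j ≤ C.width₁ * (1 / 2) ^ j := by
  induction j with
  | zero => simp [width]
  | succ j ih =>
    have h1 := C.width_eq j
    have h2 : (2 : ℝ) ≤ C.r j := by exact_mod_cast C.two_le_r j
    have h3 := C.width_pos (j + 1)
    rw [pow_succ]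
    nlinarith

lemma left_colStart {j k i : ℕ} (hk : k < C.height j) (hi : i < C.r j) :
    C.left (j + 1) (C.colStart j i + k) = C.left j k + i * C.width (j + 1) :=
  C.left_succ j k i hk hi

lemma floor_inj {j k k' : ℕ} {x : ℝ} (hk : k < C.height j) (hk' : k' < C.height j)
    (hx : x ∈ C.floor j k) (hx' : x ∈ C.floor j k') : k = k' := by
  by_contra hne
  exact Set.disjoint_left.1 (C.disjoint_floor j k k' hk hk' hne) hx hx'

lemma measurableSet_floor (j k : ℕ) : MeasurableSet (C.floor j k) := measurableSet_Ico

lemma measurableSet_tower (j : ℕ) : MeasurableSet (C.tower j) :=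
  Finset.measurableSet_biUnion _ fun _ _ => C.measurableSet_floor _ _

lemma measurableSet_space : MeasurableSet C.space :=
  MeasurableSet.iUnion fun j => C.measurableSet_tower j

lemma exists_subfloor {j k : ℕ} {x : ℝ} (hk : k < C.height j) (hx : x ∈ C.floor j k) :
    ∃ i, i < C.r j ∧ x ∈ C.floor (j + 1) (C.colStart j i + k) := by
  have hw := C.width_pos (j + 1)
  have hx1 : C.left j k ≤ x := hx.1
  have hx2 : x < C.left j k + C.width j := hx.2
  have h0 : 0 ≤ (x - C.left j k) / C.width (j + 1) := div_nonneg (by linarith) hw.le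
  have hi : ⌊(x - C.left j k) / C.width (j + 1)⌋₊ < C.r j := by
    rw [Nat.floor_lt h0, div_lt_iff₀ hw, ← C.width_eq]
    linarith
  refine ⟨_, hi, ?_⟩
  have h1 := Nat.floor_le h0
  have h2 := Nat.lt_floor_add_one ((x - C.left j k) / C.width (j + 1))
  rw [le_div_iff₀ hw] at h1
  rw [div_lt_iff₀ hw] at h2
  simp only [floor, mem_Ico, C.left_colStart hk hi]
  constructor
  · linarith
  · linarith

/-- The floors that are not on top keep the translations onto their next floors. -/
lemma exists_floor_add {j k : ℕ} {x : ℝ} (hk : k + 1 < C.height j) (hx : x ∈ C.floor j k)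
    (d : ℕ) : ∃ k', k' + 1 < C.height (j + d) ∧ x ∈ C.floor (j + d) k' ∧
      C.left (j + d) (k' + 1) - C.left (j + d) k' = C.left j (k + 1) - C.left j k := by
  induction d with
  | zero => exact ⟨k, hk, hx, rfl⟩
  | succ d ih =>
    obtain ⟨k', hk', hx', he⟩ := ih
    obtain ⟨i, hi, hxi⟩ := C.exists_subfloor (by omega) hx'
    refine ⟨C.colStart (j + d) i + k', ?_, hxi, ?_⟩
    · exact C.colStart_add_lt hi hk'
    · rw [← he]
      have h1 := C.left_colStart hk' hi
      have h2 := C.left_colStart (show k' < C.height (j + d) by omega) hi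
      rw [← add_assoc] at h1
      rw [← add_assoc, h1, h2]
      ring

lemma T_eq {j k : ℕ} {x : ℝ} (hk : k + 1 < C.height j) (hx : x ∈ C.floor j k) :
    C.T x = x + (C.left j (k + 1) - C.left j k) := by
  have h : ∃ p : ℕ × ℕ, p.2 + 1 < C.height p.1 ∧ x ∈ C.floor p.1 p.2 := ⟨(j, k), hk, hx⟩
  rw [T, dif_pos h]
  obtain ⟨hp, hpx⟩ := h.choose_spec
  obtain ⟨a, ha, hxa, hea⟩ := C.exists_floor_add hp hpx j
  obtain ⟨b, hb, hxb, heb⟩ := C.exists_floor_add hk hx h.choose.1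
  rw [add_comm j] at hb hxb heb
  have hab : a = b := C.floor_inj (by omega) (by omega) hxa hxb
  subst hab
  rw [← hea, ← heb]

/-- The union of the floors of the tower of stage `j` other than its top floor. -/
def lower (j : ℕ) : Set ℝ := ⋃ k ∈ Finset.range (C.height j - 1), C.floor j k

/-- The union of the floors of the tower of stage `j` other than its base. -/
def upper (j : ℕ) : Set ℝ := ⋃ k ∈ Finset.range (C.height j - 1), C.floor j (k + 1)

lemma mem_lower {j : ℕ} {x : ℝ} :
    x ∈ C.lower j ↔ ∃ k, k + 1 < C.height j ∧ x ∈ C.floor j k := by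
  have := C.height_pos j
  simp only [lower, mem_iUnion, Finset.mem_range, exists_prop]
  constructor <;> rintro ⟨k, hk, hx⟩ <;> exact ⟨k, by omega, hx⟩

lemma mem_upper {j : ℕ} {x : ℝ} :
    x ∈ C.upper j ↔ ∃ k, k + 1 < C.height j ∧ x ∈ C.floor j (k + 1) := by
  have := C.height_pos j
  simp only [upper, mem_iUnion, Finset.mem_range, exists_prop]
  constructor <;> rintro ⟨k, hk, hx⟩ <;> exact ⟨k, by omega, hx⟩

lemma mem_tower {j : ℕ} {x : ℝ} :
    x ∈ C.tower j ↔ ∃ k, k < C.height j ∧ x ∈ C.floor j k := by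
  simp [tower]

lemma tower_mono : Monotone C.tower := by
  refine monotone_nat_of_le_succ fun j x hx => ?_
  obtain ⟨k, hk, hx⟩ := C.mem_tower.1 hx
  obtain ⟨i, hi, hxi⟩ := C.exists_subfloor hk hx
  exact C.mem_tower.2 ⟨_, C.colStart_add_lt hi hk, hxi⟩

lemma lower_mono : Monotone C.lower := by
  refine monotone_nat_of_le_succ fun j x hx => ?_
  obtain ⟨k, hk, hx⟩ := C.mem_lower.1 hx
  obtain ⟨k', hk', hx', -⟩ := C.exists_floor_add hk hx 1
  exact C.mem_lower.2 ⟨k', hk', hx'⟩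

lemma upper_mono : Monotone C.upper := by
  refine monotone_nat_of_le_succ fun j x hx => ?_
  obtain ⟨k, hk, hx⟩ := C.mem_upper.1 hx
  obtain ⟨i, hi, hxi⟩ := C.exists_subfloor hk hx
  exact C.mem_upper.2 ⟨C.colStart j i + k, C.colStart_add_lt hi hk, hxi⟩

lemma lower_subset (j : ℕ) : C.lower j ⊆ C.tower j := fun x hx => by
  obtain ⟨k, hk, hx⟩ := C.mem_lower.1 hx
  exact C.mem_tower.2 ⟨k, by omega, hx⟩

lemma upper_subset (j : ℕ) : C.upper j ⊆ C.tower j := fun x hx => by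
  obtain ⟨k, hk, hx⟩ := C.mem_upper.1 hx
  exact C.mem_tower.2 ⟨k + 1, hk, hx⟩

lemma measurableSet_lower (j : ℕ) : MeasurableSet (C.lower j) :=
  Finset.measurableSet_biUnion _ fun _ _ => C.measurableSet_floor _ _

lemma measurableSet_upper (j : ℕ) : MeasurableSet (C.upper j) :=
  Finset.measurableSet_biUnion _ fun _ _ => C.measurableSet_floor _ _

lemma volume_null_of_subset_floor {A : Set ℝ} {j₀ : ℕ}
    (h : ∀ j, j₀ ≤ j → ∃ k, A ⊆ C.floor j k) : volume A = 0 := by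
  have hlim : Tendsto (fun j : ℕ => ENNReal.ofReal (C.width₁ * (1 / 2) ^ j)) atTop (𝓝 0) := by
    have h1 : Tendsto (fun j : ℕ => C.width₁ * (1 / 2 : ℝ) ^ j) atTop (𝓝 (C.width₁ * 0)) :=
      (tendsto_pow_atTop_nhds_zero_of_lt_one (by norm_num) (by norm_num)).const_mul _
    rw [mul_zero] at h1
    simpa using ENNReal.tendsto_ofReal h1
  refine le_antisymm (ge_of_tendsto hlim ?_) zero_le
  filter_upwards [eventually_ge_atTop j₀] with j hj
  obtain ⟨k, hk⟩ := h j hj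
  calc volume A ≤ volume (C.floor j k) := measure_mono hk
    _ = ENNReal.ofReal (C.width j) := by simp [floor]
    _ ≤ _ := ENNReal.ofReal_le_ofReal (C.width_le j)

lemma volume_space_diff_lower : volume (C.space \ ⋃ j, C.lower j) = 0 := by
  rw [space, iUnion_sdiff]
  refine measure_iUnion_null fun j₀ => C.volume_null_of_subset_floor (j₀ := j₀) fun j hj => ?_
  refine ⟨C.height j - 1, fun x hx => ?_⟩
  obtain ⟨k, hk, hxk⟩ := C.mem_tower.1 (C.tower_mono hj hx.1)
  by_cases h : k + 1 < C.height j
  · exact absurd (mem_iUnion.2 ⟨j, C.mem_lower.2 ⟨k, h, hxk⟩⟩) hx.2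
  · rwa [show C.height j - 1 = k by omega]

lemma volume_space_diff_upper : volume (C.space \ ⋃ j, C.upper j) = 0 := by
  rw [space, iUnion_sdiff]
  refine measure_iUnion_null fun j₀ => C.volume_null_of_subset_floor (j₀ := j₀) fun j hj => ?_
  refine ⟨0, fun x hx => ?_⟩
  obtain ⟨k, hk, hxk⟩ := C.mem_tower.1 (C.tower_mono hj hx.1)
  cases k with
  | zero => exact hxk
  | succ k => exact absurd (mem_iUnion.2 ⟨j, C.mem_upper.2 ⟨k, hk, hxk⟩⟩) hx.2

lemma preimage_inter_floor {j k : ℕ} (hk : k + 1 < C.height j) (A : Set ℝ) :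
    C.T ⁻¹' A ∩ C.floor j k =
      (fun x => x + (C.left j (k + 1) - C.left j k)) ⁻¹' (A ∩ C.floor j (k + 1)) := by
  ext x
  constructor
  · rintro ⟨hA, hx⟩
    have hT := C.T_eq hk hx
    refine ⟨by simpa only [mem_preimage, hT] using hA, ?_⟩
    simp only [floor, mem_Ico] at hx ⊢
    constructor <;> linarith [hx.1, hx.2]
  · rintro ⟨hA, hx⟩
    have hx' : x ∈ C.floor j k := by
      simp only [floor, mem_Ico] at hx ⊢
      constructor <;> linarith [hx.1, hx.2]
    exact ⟨by simpa only [mem_preimage, C.T_eq hk hx'] using hA, hx'⟩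

lemma preimage_inter_lower (j : ℕ) (A : Set ℝ) :
    C.T ⁻¹' A ∩ C.lower j =
      ⋃ k ∈ Finset.range (C.height j - 1), C.T ⁻¹' A ∩ C.floor j k := by
  simp only [lower, inter_iUnion]

lemma measurable_T : Measurable C.T := by
  intro A hA
  have hsplit : C.T ⁻¹' A =
      (⋃ j, C.T ⁻¹' A ∩ C.lower j) ∪ (A ∩ (⋃ j, C.lower j)ᶜ) := by
    ext x
    by_cases hx : x ∈ ⋃ j, C.lower j
    · have : ∃ j, x ∈ C.lower j := mem_iUnion.1 hx
      simp [this]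
    · have hT : C.T x = x := by
        rw [T, dif_neg]
        rintro ⟨p, hp, hxp⟩
        exact hx (mem_iUnion.2 ⟨p.1, C.mem_lower.2 ⟨p.2, hp, hxp⟩⟩)
      have : ∀ j, x ∉ C.lower j := by simpa using hx
      simp [this, hT]
  rw [hsplit]
  refine (MeasurableSet.iUnion fun j => ?_).union
    (hA.inter (MeasurableSet.iUnion fun j => C.measurableSet_lower j).compl)
  rw [preimage_inter_lower]
  refine Finset.measurableSet_biUnion _ fun k hk => ?_
  rw [C.preimage_inter_floor (by have := Finset.mem_range.1 hk; omega)]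
  exact (measurable_add_const _) (hA.inter (C.measurableSet_floor _ _))

lemma volume_preimage_inter_lower {A : Set ℝ} (hA : MeasurableSet A) (j : ℕ) :
    volume (C.T ⁻¹' A ∩ C.lower j) = volume (A ∩ C.upper j) := by
  have hu : A ∩ C.upper j =
      ⋃ k ∈ Finset.range (C.height j - 1), A ∩ C.floor j (k + 1) := by
    simp only [upper, inter_iUnion]
  rw [preimage_inter_lower, hu, measure_biUnion_finset, measure_biUnion_finset]
  · refine Finset.sum_congr rfl fun k hk => ?_
    rw [C.preimage_inter_floor (by have := Finset.mem_range.1 hk; omega), measure_preimage_add_right]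
  · intro k hk k' hk' hne
    have hk := Finset.mem_range.1 hk
    have hk' := Finset.mem_range.1 hk'
    exact (C.disjoint_floor j (k + 1) (k' + 1) (by omega) (by omega) (by omega)).mono
      inter_subset_right inter_subset_right
  · exact fun k _ => hA.inter (C.measurableSet_floor _ _)
  · intro k hk k' hk' hne
    have hk := Finset.mem_range.1 hk
    have hk' := Finset.mem_range.1 hk'
    exact (C.disjoint_floor j k k' (by omega) (by omega) hne).mono
      inter_subset_right inter_subset_right
  · exact fun k _ => (C.measurable_T hA).inter (C.measurableSet_floor _ _)

lemma volume_inter_space {L : ℕ → Set ℝ} (hL : Monotone L) (hsub : ∀ j, L j ⊆ C.tower j)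
    (hnull : volume (C.space \ ⋃ j, L j) = 0) (A : Set ℝ) :
    volume (A ∩ C.space) = ⨆ j, volume (A ∩ L j) := by
  have hm : Monotone fun j => A ∩ L j := fun i j hij => inter_subset_inter_right _ (hL hij)
  rw [← hm.measure_iUnion, ← inter_iUnion]
  refine le_antisymm ?_ (measure_mono (inter_subset_inter_right _ (iUnion_mono hsub)))
  calc volume (A ∩ C.space)
      ≤ volume ((A ∩ ⋃ j, L j) ∪ (C.space \ ⋃ j, L j)) := measure_mono fun x hx => by
        by_cases h : x ∈ ⋃ j, L j
        · exact Or.inl ⟨hx.1, h⟩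
        · exact Or.inr ⟨hx.2, h⟩
    _ ≤ _ := measure_union_le _ _
    _ = _ := by rw [hnull, add_zero]

/-- The rank-one transformation preserves Lebesgue measure on the phase space. -/
theorem measurePreserving_T : MeasurePreserving C.T C.μ C.μ := by
  refine ⟨C.measurable_T, Measure.ext fun A hA => ?_⟩
  rw [Measure.map_apply C.measurable_T hA, μ, Measure.restrict_apply (C.measurable_T hA),
    Measure.restrict_apply hA,
    C.volume_inter_space C.lower_mono C.lower_subset C.volume_space_diff_lower,
    C.volume_inter_space C.upper_mono C.upper_subset C.volume_space_diff_upper]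
  simp only [C.volume_preimage_inter_lower hA]

lemma ae_mem_lower : C.μ (⋃ j, C.lower j)ᶜ = 0 := by
  rw [μ, Measure.restrict_apply (MeasurableSet.iUnion fun j => C.measurableSet_lower j).compl,
    inter_comm, ← sdiff_eq]
  exact C.volume_space_diff_lower

lemma injOn_T : InjOn C.T (⋃ j, C.lower j) := by
  intro x hx y hy hxy
  obtain ⟨j, hx⟩ := mem_iUnion.1 hx
  obtain ⟨j', hy⟩ := mem_iUnion.1 hy
  obtain ⟨k, hk, hxk⟩ := C.mem_lower.1 (C.lower_mono (le_max_left j j') hx)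
  obtain ⟨k', hk', hyk⟩ := C.mem_lower.1 (C.lower_mono (le_max_right j j') hy)
  have hTx := C.T_eq hk hxk
  have hTy := C.T_eq hk' hyk
  have hx1 : C.T x ∈ C.floor (max j j') (k + 1) := by
    rw [hTx]
    simp only [floor, mem_Ico] at hxk ⊢
    constructor <;> linarith [hxk.1, hxk.2]
  have hy1 : C.T x ∈ C.floor (max j j') (k' + 1) := by
    rw [hxy, hTy]
    simp only [floor, mem_Ico] at hyk ⊢
    constructor <;> linarith [hyk.1, hyk.2]
  have hkk : k = k' := by
    have := C.floor_inj hk hk' hx1 hy1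
    omega
  subst hkk
  linarith

end RankOneConstruction

/-- The Koopman operator of a measure-preserving transformation of a standard Borel space that is
injective off a null set is onto. -/
lemma surjective_koopman {α : Type*} [MeasurableSpace α] [StandardBorelSpace α] {μ : Measure α}
    {f : α → α} (hf : MeasurePreserving f μ μ) {A : Set α} (hA : MeasurableSet A)
    (hnull : μ Aᶜ = 0) (hinj : InjOn f A) :
    Function.Surjective (Lp.compMeasurePreservingₗᵢ (E := ℂ) (p := 2) ℂ f hf) := by
  intro g
  have hg := (Lp.aestronglyMeasurable g)
  have : StandardBorelSpace A := hA.standardBorel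
  have he : MeasurableEmbedding (fun a : A => f a) :=
    (hf.measurable.comp measurable_subtype_coe).measurableEmbedding
      (fun a b hab => Subtype.ext (hinj a.2 b.2 hab))
  obtain ⟨u, hu, hue⟩ := he.exists_measurable_extend
    (g := fun a : A => hg.mk g a)
    (hg.stronglyMeasurable_mk.measurable.comp measurable_subtype_coe) (fun _ => ⟨0⟩)
  have hug : u ∘ f =ᵐ[μ] g := by
    have hAe : ∀ᵐ x ∂μ, x ∈ A := hnull
    filter_upwards [hAe, hg.ae_eq_mk] with x hx hgx
    rw [hgx]
    exact congrFun hue ⟨x, hx⟩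
  have huL : MemLp u 2 μ := by
    have h1 : MemLp (u ∘ f) 2 μ := (memLp_congr_ae hug).2 (Lp.memLp g)
    rw [← hf.map_eq]
    exact (memLp_map_measure_iff hu.aestronglyMeasurable hf.measurable.aemeasurable).2 h1
  refine ⟨huL.toLp u, ?_⟩
  change Lp.compMeasurePreserving f hf (huL.toLp u) = g
  rw [Lp.toLp_compMeasurePreserving]
  exact Lp.ext ((MemLp.coeFn_toLp _).trans hug)

namespace RankOneConstruction

variable (C : RankOneConstruction)

/-- The measure `μ × ⋯ × μ` on the `n`-th Cartesian power of the phase space. -/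
noncomputable abbrev μpow (n : ℕ) : Measure (Fin n → ℝ) := Measure.pi fun _ => C.μ

/-- The `n`-th Cartesian power `T × ⋯ × T` of the rank-one transformation. -/
noncomputable def Tpow (n : ℕ) (x : Fin n → ℝ) : Fin n → ℝ := fun i => C.T (x i)

lemma measurePreserving_Tpow (n : ℕ) : MeasurePreserving (C.Tpow n) (C.μpow n) (C.μpow n) :=
  measurePreserving_pi (fun _ => C.μ) (fun _ => C.μ) fun _ => C.measurePreserving_T

lemma surjective_koopman_Tpow (n : ℕ) : Function.Surjective
    (Lp.compMeasurePreservingₗᵢ (E := ℂ) (p := 2) ℂ (C.Tpow n) (C.measurePreserving_Tpow n)) := by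
  have hm : MeasurableSet (⋃ j, C.lower j) := MeasurableSet.iUnion fun j => C.measurableSet_lower j
  refine surjective_koopman _ (A := Set.pi univ fun _ => ⋃ j, C.lower j)
    (MeasurableSet.univ_pi fun _ => hm) ?_ ?_
  · have h : ∀ i : Fin n, ∀ᵐ x ∂(C.μpow n), x i ∈ ⋃ j, C.lower j := fun i =>
      (Measure.quasiMeasurePreserving_eval (μ := fun _ : Fin n => C.μ) i).ae
        (p := fun y => y ∈ ⋃ j, C.lower j) C.ae_mem_lower
    have h2 : ∀ᵐ x ∂(C.μpow n), x ∈ Set.pi univ fun _ : Fin n => ⋃ j, C.lower j := by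
      filter_upwards [ae_all_iff.2 h] with x hx i _ using hx i
    exact h2
  · intro x hx y hy hxy
    funext i
    exact C.injOn_T (hx i (mem_univ i)) (hy i (mem_univ i)) (congrFun hxy i)

/-- The tensor power `T^{⊗n}` of the unitary operator `f ↦ f ∘ T` on `L²(X, μ)`, as the unitary
operator `F ↦ F ∘ (T × ⋯ × T)` on `L²(Xⁿ, μⁿ) = L²(X, μ)^{⊗n}`. -/
noncomputable def tensorPower (n : ℕ) : Lp ℂ 2 (C.μpow n) ≃ₗᵢ[ℂ] Lp ℂ 2 (C.μpow n) :=
  LinearIsometryEquiv.ofSurjective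
    (Lp.compMeasurePreservingₗᵢ ℂ (C.Tpow n) (C.measurePreserving_Tpow n))
    (C.surjective_koopman_Tpow n)

/-- The Sidon property: for `h_j < m ≤ h_{j+1}`, the intersection `T^m X_j ∩ X_j` is contained
(up to a null set) in one of the columns of the tower `X_j`. -/
def IsSidon : Prop :=
  ∀ j m, C.height j < m → m ≤ C.height (j + 1) →
    ∃ i, i < C.r j ∧ C.μ ((C.T^[m] '' C.tower j ∩ C.tower j) \ C.column j i) = 0

/-- Sidon constructions of class `C(ν)`. -/
structure IsSidonOfClass (ν : ℝ) : Prop where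
  sidon : C.IsSidon
  columnGrowth : C.ColumnGrowth ν
  fastSpacers : C.FastSpacers

end RankOneConstruction

section Spectrum

variable {H : Type*} [NormedAddCommGroup H] [InnerProductSpace ℂ H]

/-- `σ` is the spectral measure of the vector `f` for the unitary operator `U`: a finite measure on
the circle `ℝ/ℤ` whose Fourier coefficients are `∫ exp(2πimt) dσ(t) = ⟨U^m f, f⟩`, `m ∈ ℤ`. (The
inner product `inner ℂ x y` is linear in `y`.) -/
def IsSpectralMeasure (U : H ≃ₗᵢ[ℂ] H) (f : H) (σ : Measure UnitAddCircle) : Prop :=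
  IsFiniteMeasure σ ∧ ∀ m : ℤ, ∫ t, fourier m t ∂σ = inner ℂ f ((U ^ m) f)

/-- The spectrum of `U` is singular: every vector has a spectral measure, singular with respect to
Lebesgue measure on the circle. -/
def HasSingularSpectrum (U : H ≃ₗᵢ[ℂ] H) : Prop :=
  ∀ f, ∃ σ, IsSpectralMeasure U f σ ∧ σ ⟂ₘ volume

/-- The spectrum of `U` is absolutely continuous: every vector has a spectral measure, absolutely
continuous with respect to Lebesgue measure on the circle. -/
def HasAbsolutelyContinuousSpectrum (U : H ≃ₗᵢ[ℂ] H) : Prop :=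
  ∀ f, ∃ σ, IsSpectralMeasure U f σ ∧ σ ≪ volume

end Spectrum

/-! The indicators of products of floors span a dense subspace (`topologicalClosure_span_boxVec`),
and up to a constant the Fourier coefficients of their spectral measures are `corr L m ^ n`, where
`corr L` is the normalized autocorrelation of the base of stage `L` (`inner_boxVec`). Let $h$, $r$,
$c_i$ be the height, the number of columns and the column starts of a stage $j\ge L$. The spacers
grow so fast that the differences $c_i-c_{i'}$, $i\ne i'$, are at least $2h$ apart from each other
and from $0$. Hence for $h\le|m|<h_{j+1}$ the correlation is nonzero only if $m=c_i-c_{i'}+x$ with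
$|x|<h$, and then it is `corr L x / r` (`corr_shift`).

Absolutely continuous case. Passing one stage multiplies $\sum_m$ `corr L m ^ (2n)` by at most
$1+r^2/r^{2n}$, so the Fourier coefficients are square summable once $\sum_j r_j^{2-2n}<\infty$
(`summable_corr_pow`). A block of $\lfloor r^\nu\rfloor$ stages with the same $r$ contributes about
$r^{\nu+2-2n}$, which is summable over the blocks if $\nu<2n-2$. Square summable coefficients imply
absolute continuity (`absolutelyContinuous_volume_of_summable`).

Singular case. If $\nu\ge 2n-2$, each block contributes at least $1$ and the series diverges. In
$L^2(\sigma)$ the exponentials $z^{c_i-c_{i'}}$ have correlation proportional to $r^{-n}$ with $1$,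
behave like independent variables when they come from different stages, and have small total
correlation within one stage. Their combination $Q$ with weights $r^{-n}/S$, where $S$ is the sum of
$r^{-2n}$ over the pairs in use, satisfies $\|1-Q\|^2=O(1/S)$ in $L^2(\sigma)$ and $\|Q\|^2=1/S$ for
Lebesgue measure (`exists_trigPoly`). As $S\to\infty$, the two measures are mutually singular
(`mutuallySingular_volume_of_trigPoly`). -/

/-! ### Existence of spectral measures. -/

section FunctionalCalculus

variable {H : Type*} [NormedAddCommGroup H] [InnerProductSpace ℂ H]

/-- The continuous functional calculus of a unitary operator, for functions on `ℝ/ℤ`. -/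
lemma exists_circle_functionalCalculus [CompleteSpace H] (U : H ≃ₗᵢ[ℂ] H) :
    ∃ Φ : C(UnitAddCircle, ℂ) →⋆ₐ[ℂ] (H →L[ℂ] H), ∀ (m : ℤ) (f : H),
      Φ (fourier m) f = (U ^ m) f := by
  set u : unitary (H →L[ℂ] H) := Unitary.linearIsometryEquiv.symm U with hu
  have hnormal : IsStarNormal (u : H →L[ℂ] H) := inferInstance
  have hmem : ∀ z : spectrum ℂ (u : H →L[ℂ] H), (z : ℂ) ∈ Submonoid.unitSphere ℂ := fun z =>
    spectrum.subset_circle_of_unitary u.2 z.2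
  let w : spectrum ℂ (u : H →L[ℂ] H) → Circle := fun z => ⟨z, hmem z⟩
  have hw : Continuous w := Continuous.subtype_mk continuous_subtype_val _
  let e := AddCircle.homeomorphCircle (one_ne_zero (α := ℝ))
  -- The spectrum of a unitary operator lies on the circle, so functions on `ℝ/ℤ` pull back to it
  -- along `θ`.
  let θ : C(spectrum ℂ (u : H →L[ℂ] H), UnitAddCircle) := ⟨fun z => e.symm (w z), by fun_prop⟩
  let Φ : C(UnitAddCircle, ℂ) →⋆ₐ[ℂ] (H →L[ℂ] H) :=
    (cfcHom hnormal).comp (ContinuousMap.compStarAlgHom' ℂ ℂ θ)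
  have h1 : Φ (fourier 1) = u := by
    rw [← cfcHom_id (R := ℂ) hnormal]
    change cfcHom hnormal _ = _
    congr 1
    ext z
    have h : e (θ z) = w z := e.apply_symm_apply (w z)
    have h' : ((θ z).toCircle : ℂ) = z := by
      rw [← AddCircle.homeomorphCircle_apply (one_ne_zero (α := ℝ)) (θ z)]
      exact congrArg (fun c : Circle => (c : ℂ)) h
    change fourier 1 (θ z) = z
    rw [fourier_one, h']
  have hneg : ∀ m : ℤ, Φ (fourier (-m)) = star (Φ (fourier m)) := fun m => by
    rw [← map_star]
    congr 1
    ext t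
    simp
  have hmul : ∀ m k : ℤ, Φ (fourier (m + k)) = Φ (fourier m) * Φ (fourier k) := fun m k => by
    rw [← map_mul]
    congr 1
    ext t
    exact fourier_add
  have h0 : Φ (fourier 0) = 1 := by
    rw [← map_one Φ]
    congr 1
    ext t
    simp
  have hpow : ∀ m : ℤ, Φ (fourier m) = ((u ^ m : unitary (H →L[ℂ] H)) : H →L[ℂ] H) := by
    intro m
    induction m with
    | zero => simpa using h0
    | succ i ih => rw [hmul, ih, h1, zpow_add_one]; rfl
    | pred i ih =>
      rw [sub_eq_add_neg, hmul, ih, hneg, h1, zpow_add, zpow_neg_one]; rfl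
  refine ⟨Φ, fun m f => ?_⟩
  rw [hpow m]
  have hU : U = Unitary.linearIsometryEquiv u := by simp [hu]
  rw [show (U ^ m) = Unitary.linearIsometryEquiv (u ^ m) by rw [map_zpow, ← hU]]
  rfl

/-- Every vector has a spectral measure for a unitary operator. -/
theorem exists_isSpectralMeasure [CompleteSpace H] (U : H ≃ₗᵢ[ℂ] H) (f : H) :
    ∃ σ, IsSpectralMeasure U f σ := by
  obtain ⟨Φ, hΦ⟩ := exists_circle_functionalCalculus U
  let ι : C(UnitAddCircle, ℝ) → C(UnitAddCircle, ℂ) := fun g => ⟨fun t => (g t : ℂ), by fun_prop⟩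
  -- With $q=\sqrt g$ the inner product equals $\|\Phi(q)f\|^2$.
  have hpos : ∀ g : C(UnitAddCircle, ℝ), 0 ≤ g → 0 ≤ (inner ℂ f (Φ (ι g) f)).re := by
    intro g hg
    let q : C(UnitAddCircle, ℝ) := ⟨fun t => √(g t), by fun_prop⟩
    have hq : ι g = star (ι q) * ι q := by
      ext t
      simp only [ι, q, ContinuousMap.coe_mk, ContinuousMap.mul_apply, ContinuousMap.star_apply,
        RCLike.star_def, Complex.conj_ofReal]
      rw [← Complex.ofReal_mul, Real.mul_self_sqrt (show 0 ≤ g t from hg t)]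
    rw [hq, map_mul, map_star, mul_apply_eq_comp, ContinuousLinearMap.star_eq_adjoint,
      ContinuousLinearMap.adjoint_inner_right]
    exact inner_self_nonneg (𝕜 := ℂ)
  let ℓ : CompactlySupportedContinuousMap UnitAddCircle ℝ →ₗ[ℝ] ℝ :=
    { toFun := fun g => (inner ℂ f (Φ (ι g.toContinuousMap) f)).re
      map_add' := fun g g' => by
        have : ι (g + g').toContinuousMap = ι g.toContinuousMap + ι g'.toContinuousMap := by
          ext t; simp [ι]
        rw [this, map_add, add_apply, inner_add_right, Complex.add_re]
      map_smul' := fun c g => by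
        have : ι (c • g).toContinuousMap = (c : ℂ) • ι g.toContinuousMap := by
          ext t; simp [ι]
        rw [this, map_smul, smul_apply, inner_smul_right,
          Complex.re_ofReal_mul]
        rfl }
  let Λ := PositiveLinearMap.mk₀ ℓ fun g hg => hpos _ hg
  have hΛ : ∀ g : C(UnitAddCircle, ℝ), ∫ t, g t ∂(RealRMK.rieszMeasure Λ) =
      (inner ℂ f (Φ (ι g) f)).re := fun g =>
    RealRMK.integral_rieszMeasure Λ ⟨g, HasCompactSupport.of_compactSpace _⟩
  -- Real functions give self-adjoint operators, so the real part taken in `ℓ` loses nothing.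
  have hre : ∀ g : C(UnitAddCircle, ℝ), (inner ℂ f (Φ (ι g) f)).im = 0 := fun g => by
    rw [← Complex.conj_eq_iff_im, inner_conj_symm]
    have : star (ι g) = ι g := by ext t; simp [ι]
    rw [← ContinuousLinearMap.adjoint_inner_right, ← ContinuousLinearMap.star_eq_adjoint,
      ← map_star, this]
  refine ⟨RealRMK.rieszMeasure Λ, inferInstance, fun m => ?_⟩
  let a : C(UnitAddCircle, ℝ) := ⟨fun t => (fourier m t).re, by fun_prop⟩
  let b : C(UnitAddCircle, ℝ) := ⟨fun t => (fourier m t).im, by fun_prop⟩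
  have hab : (fourier m : C(UnitAddCircle, ℂ)) = ι a + Complex.I • ι b := by
    ext t
    simp only [ι, a, b, ContinuousMap.coe_mk, ContinuousMap.add_apply, ContinuousMap.smul_apply,
      smul_eq_mul]
    rw [mul_comm, Complex.re_add_im]
  have hint : Integrable (fun t => fourier m t) (RealRMK.rieszMeasure Λ) :=
    (fourier m).continuous.integrable_of_hasCompactSupport (HasCompactSupport.of_compactSpace _)
  rw [← integral_re_add_im hint, ← hΦ, hab, map_add, map_smul, add_apply,
    smul_apply, inner_add_right, inner_smul_right]
  have e1 := hΛ a
  have e2 := hΛ b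
  have e3 : ∀ g, inner ℂ f (Φ (ι g) f) = ((inner ℂ f (Φ (ι g) f)).re : ℂ) := fun g =>
    Complex.ext (by simp) (by simp [hre g])
  rw [e3 a, e3 b, ← e1, ← e2, mul_comm]
  simp [a, b, ι, mul_comm]

end FunctionalCalculus

/-! ### Trigonometric polynomials and a criterion of singularity. -/

section TrigonometricPolynomials

lemma integrable_of_continuous_circle {E : Type*} [NormedAddCommGroup E] (σ : Measure UnitAddCircle)
    [IsFiniteMeasure σ] {p : UnitAddCircle → E} (hp : Continuous p) : Integrable p σ :=
  hp.integrable_of_hasCompactSupport (HasCompactSupport.of_compactSpace _)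

lemma integral_norm_sq_trigPoly {ι : Type*} (σ : Measure UnitAddCircle) [IsFiniteMeasure σ]
    (s : Finset ι) (c : ι → ℂ) (m : ι → ℤ) :
    ((∫ t, ‖∑ x ∈ s, c x * fourier (m x) t‖ ^ 2 ∂σ : ℝ) : ℂ) =
      ∑ x ∈ s, ∑ y ∈ s, starRingEnd ℂ (c x) * c y * ∫ t, fourier (m y - m x) t ∂σ := by
  rw [← integral_complex_ofReal]
  have h : ∀ t : UnitAddCircle, ((‖∑ x ∈ s, c x * fourier (m x) t‖ ^ 2 : ℝ) : ℂ) =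
      ∑ x ∈ s, ∑ y ∈ s, starRingEnd ℂ (c x) * c y * fourier (m y - m x) t := fun t => by
    rw [Complex.ofReal_pow, ← Complex.conj_mul', map_sum, Finset.sum_mul_sum]
    refine Finset.sum_congr rfl fun x _ => Finset.sum_congr rfl fun y _ => ?_
    rw [sub_eq_add_neg, fourier_add, fourier_neg, map_mul]
    ring
  simp_rw [h]
  rw [integral_finsetSum _ fun x _ => integrable_of_continuous_circle σ (by fun_prop)]
  refine Finset.sum_congr rfl fun x _ => ?_
  rw [integral_finsetSum _ fun x _ => integrable_of_continuous_circle σ (by fun_prop)]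
  exact Finset.sum_congr rfl fun y _ => integral_const_mul _ _

lemma integral_fourier_volume (m : ℤ) :
    ∫ t : UnitAddCircle, fourier m t = if m = 0 then 1 else 0 := by
  have h := congrFun (fourierCoeff_fourier (T := 1) m) 0
  simp only [fourierCoeff, neg_zero, fourier_zero, one_smul] at h
  rw [AddCircle.integral_haarAddCircle] at h
  simp only [inv_one, one_smul] at h
  rw [h]
  simp only [Pi.single_apply, eq_comm]

/-- The squared `L²` distance from `1` to a trigonometric polynomial with real coefficients. -/
lemma integral_norm_one_sub_trigPoly_sq {ι : Type*} (σ : Measure UnitAddCircle) [IsFiniteMeasure σ]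
    {γ : ℤ → ℝ} (hγ : ∀ m, ∫ t, fourier m t ∂σ = (γ m : ℂ))
    (s : Finset ι) (a : ι → ℝ) (m : ι → ℤ) :
    ∫ t, ‖1 - ∑ x ∈ s, (a x : ℂ) * fourier (m x) t‖ ^ 2 ∂σ =
      γ 0 - 2 * ∑ x ∈ s, a x * γ (m x) +
        ∑ x ∈ s, ∑ y ∈ s, a x * a y * γ (m y - m x) := by
  have h2 : ∫ t, ‖∑ x ∈ s, (a x : ℂ) * fourier (m x) t‖ ^ 2 ∂σ =
      ∑ x ∈ s, ∑ y ∈ s, a x * a y * γ (m y - m x) := by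
    have := integral_norm_sq_trigPoly σ s (fun x => (a x : ℂ)) m
    simp only [hγ, Complex.conj_ofReal] at this
    exact_mod_cast this
  have h1 : ∫ t, (∑ x ∈ s, (a x : ℂ) * fourier (m x) t).re ∂σ = ∑ x ∈ s, a x * γ (m x) := by
    have e : ∫ t, ∑ x ∈ s, (a x : ℂ) * fourier (m x) t ∂σ = ((∑ x ∈ s, a x * γ (m x) : ℝ) : ℂ) := by
      rw [integral_finsetSum _ fun x _ => integrable_of_continuous_circle σ (by fun_prop)]
      push_cast
      exact Finset.sum_congr rfl fun x _ => by rw [integral_const_mul, hγ]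
    have := integral_re (integrable_of_continuous_circle σ
      (p := fun t => ∑ x ∈ s, (a x : ℂ) * fourier (m x) t) (by fun_prop))
    rw [e] at this
    simpa using this
  have h0 : ∫ _t, (1 : ℝ) ∂σ = γ 0 := by
    have := hγ 0
    simp only [fourier_zero, integral_const, Complex.real_smul, mul_one] at this
    simpa using this
  have hexp : ∀ z : ℂ, ‖1 - z‖ ^ 2 = 1 - 2 * z.re + ‖z‖ ^ 2 := fun z => by
    rw [Complex.sq_norm, Complex.sq_norm, Complex.normSq_apply, Complex.normSq_apply]
    simp
    ring
  simp_rw [hexp]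
  rw [integral_add, integral_sub, integral_const_mul, h0, h1, h2]
  all_goals exact integrable_of_continuous_circle σ (by fun_prop)

/-- Borel–Cantelli with $\varepsilon=2^{-k}$: the points in infinitely many $G_k$ are null for `τ`,
those in infinitely many complements are null for `σ`, and every point is of one of these kinds. -/
lemma mutuallySingular_of_forall_exists_measure_le {α : Type*} [MeasurableSpace α]
    {σ τ : Measure α}
    (h : ∀ ε : ℝ, 0 < ε → ∃ G : Set α, τ G ≤ ENNReal.ofReal ε ∧ σ Gᶜ ≤ ENNReal.ofReal ε) :
    σ ⟂ₘ τ := by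
  choose G hτ hσ using fun k : ℕ => h ((1 / 2) ^ k) (by positivity)
  have hsum : ∑' k : ℕ, ENNReal.ofReal ((1 / 2 : ℝ) ^ k) ≠ ⊤ :=
    (summable_geometric_of_lt_one (by norm_num) (by norm_num :
      (1 / 2 : ℝ) < 1)).tsum_ofReal_ne_top
  have h1 : τ (limsup G atTop) = 0 := measure_limsup_atTop_eq_zero
    (ne_top_of_le_ne_top hsum (ENNReal.tsum_le_tsum hτ))
  have h2 : σ (limsup (fun k => (G k)ᶜ) atTop) = 0 := measure_limsup_atTop_eq_zero
    (ne_top_of_le_ne_top hsum (ENNReal.tsum_le_tsum hσ))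
  refine Measure.MutuallySingular.mk h2 h1 fun x _ => ?_
  simp only [Set.mem_union, mem_limsup_iff_frequently_mem]
  by_contra hcon
  rw [not_or, not_frequently, not_frequently] at hcon
  obtain ⟨k, hk1, hk2⟩ := (hcon.1.and hcon.2).exists
  exact hk1 hk2

lemma measure_one_half_le {α : Type*} [MeasurableSpace α] {σ : Measure α} {u : α → ℝ}
    (hu : Integrable (fun x => u x ^ 2) σ) {ε : ℝ} (h : ∫ x, u x ^ 2 ∂σ ≤ ε) :
    σ {x | 1 / 2 ≤ |u x|} ≤ ENNReal.ofReal (4 * ε) := by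
  have h1 := mul_meas_ge_le_lintegral₀ (μ := σ) (f := fun x => ENNReal.ofReal (u x ^ 2))
    hu.aemeasurable.ennreal_ofReal (ENNReal.ofReal (1 / 4))
  rw [← ofReal_integral_eq_lintegral_ofReal hu (ae_of_all _ fun x => sq_nonneg _)] at h1
  have hsub : {x | 1 / 2 ≤ |u x|} ⊆ {x | ENNReal.ofReal (1 / 4) ≤ ENNReal.ofReal (u x ^ 2)} := by
    intro x hx
    refine ENNReal.ofReal_le_ofReal ?_
    rw [← sq_abs]
    have : 1 / 2 ≤ |u x| := hx
    nlinarith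
  calc σ {x | 1 / 2 ≤ |u x|} ≤ σ {x | ENNReal.ofReal (1 / 4) ≤ ENNReal.ofReal (u x ^ 2)} :=
        measure_mono hsub
    _ = ENNReal.ofReal 4 * (ENNReal.ofReal (1 / 4) *
          σ {x | ENNReal.ofReal (1 / 4) ≤ ENNReal.ofReal (u x ^ 2)}) := by
        rw [← mul_assoc, ← ENNReal.ofReal_mul (by norm_num)]
        norm_num
    _ ≤ ENNReal.ofReal 4 * ENNReal.ofReal ε := by
        gcongr
        exact h1.trans (ENNReal.ofReal_le_ofReal h)
    _ = ENNReal.ofReal (4 * ε) := (ENNReal.ofReal_mul (by norm_num)).symm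

/-- A measure on the circle is singular if trigonometric polynomials of small `L²` norm with
respect to Lebesgue measure come close to `1` in its own `L²` space. -/
theorem mutuallySingular_volume_of_trigPoly {ι : Type*} {σ : Measure UnitAddCircle}
    [IsFiniteMeasure σ] {γ : ℤ → ℝ} (hγ : ∀ m, ∫ t, fourier m t ∂σ = (γ m : ℂ))
    (h : ∀ ε : ℝ, 0 < ε → ∃ (s : Finset ι) (a : ι → ℝ) (m : ι → ℤ),
      γ 0 - 2 * ∑ x ∈ s, a x * γ (m x) + ∑ x ∈ s, ∑ y ∈ s, a x * a y * γ (m y - m x) ≤ ε ∧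
      Set.InjOn m s ∧ ∑ x ∈ s, a x ^ 2 ≤ ε) :
    σ ⟂ₘ volume := by
  classical
  refine mutuallySingular_of_forall_exists_measure_le fun ε hε => ?_
  obtain ⟨s, a, m, h1, hinj, h2⟩ := h (ε / 4) (by positivity)
  rw [← integral_norm_one_sub_trigPoly_sq σ hγ] at h1
  have h3 : ∫ t : UnitAddCircle, ‖∑ x ∈ s, (a x : ℂ) * fourier (m x) t‖ ^ 2 ≤ ε / 4 := by
    have e := integral_norm_sq_trigPoly volume s (fun x => (a x : ℂ)) m
    have e' : ∀ x ∈ s, ∑ y ∈ s, starRingEnd ℂ (a x : ℂ) * (a y : ℂ) *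
        ∫ t : UnitAddCircle, fourier (m y - m x) t = ((a x ^ 2 : ℝ) : ℂ) := by
      intro x hx
      rw [Finset.sum_eq_single x]
      · rw [sub_self, integral_fourier_volume, if_pos rfl]
        simp [sq]
      · intro y hy hyx
        rw [integral_fourier_volume, if_neg, mul_zero]
        intro h0
        exact hyx (hinj hy hx (by omega))
      · exact fun hx' => absurd hx hx'
    rw [Finset.sum_congr rfl e', ← Complex.ofReal_sum, Complex.ofReal_inj] at e
    rw [e]
    exact h2
  -- Where the polynomial has modulus below $1/2$, its distance to $1$ exceeds $1/2$. Chebyshev's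
  -- inequality bounds both sets at the cost of a factor $4$, hence the choice `ε / 4`.
  refine ⟨{t | 1 / 2 ≤ |‖∑ x ∈ s, (a x : ℂ) * fourier (m x) t‖|}, ?_, ?_⟩
  · convert measure_one_half_le (integrable_of_continuous_circle _ (by fun_prop)) h3 using 2
    ring
  · have : ENNReal.ofReal ε = ENNReal.ofReal (4 * (ε / 4)) := by ring_nf
    rw [this]
    refine le_trans (measure_mono fun t ht => ?_)
      (measure_one_half_le (integrable_of_continuous_circle σ (by fun_prop)) h1)
    simp only [abs_norm, mem_compl_iff, mem_ofPred_eq, not_le] at ht ⊢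
    have := norm_sub_norm_le (1 : ℂ) (∑ x ∈ s, (a x : ℂ) * fourier (m x) t)
    rw [norm_one] at this
    linarith

end TrigonometricPolynomials

/-! ### Comparison of spectral measures and passage to total sets. -/

section Comparison

variable {H : Type*} [NormedAddCommGroup H] [InnerProductSpace ℂ H]

/-- The functions $z^m$ in $L^2(\sigma)$ and the vectors $U^mf$ have the same Gram matrix. -/
lemma integral_norm_sq_eq_of_isSpectralMeasure {ι : Type*} {U : H ≃ₗᵢ[ℂ] H} {f : H}
    {σ : Measure UnitAddCircle} (hσ : IsSpectralMeasure U f σ) (s : Finset ι) (c : ι → ℂ)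
    (m : ι → ℤ) :
    ∫ t, ‖∑ x ∈ s, c x * fourier (m x) t‖ ^ 2 ∂σ = ‖∑ x ∈ s, c x • (U ^ m x) f‖ ^ 2 := by
  have := hσ.1
  have h := integral_norm_sq_trigPoly σ s c m
  have hU : ∀ a b : ℤ, inner ℂ f ((U ^ (b - a)) f) = inner ℂ ((U ^ a) f) ((U ^ b) f) :=
    fun a b => by
      rw [← (U ^ a).inner_map_map f, show (U ^ a) ((U ^ (b - a)) f) = (U ^ a * U ^ (b - a)) f from rfl,
        ← zpow_add, add_sub_cancel]
  have h2 : ((‖∑ x ∈ s, c x • (U ^ m x) f‖ ^ 2 : ℝ) : ℂ) =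
      ∑ x ∈ s, ∑ y ∈ s, starRingEnd ℂ (c x) * c y * ∫ t, fourier (m y - m x) t ∂σ := by
    have e := inner_self_eq_norm_sq_to_K (𝕜 := ℂ) (∑ x ∈ s, c x • (U ^ m x) f)
    rw [RCLike.ofReal_eq_complex_ofReal, ← Complex.ofReal_pow] at e
    rw [← e, sum_inner]
    refine Finset.sum_congr rfl fun x _ => ?_
    rw [inner_sum]
    refine Finset.sum_congr rfl fun y _ => ?_
    rw [inner_smul_left, inner_smul_right, hσ.2, hU, mul_assoc]
  rw [← h2] at h
  exact_mod_cast h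

lemma exists_finset_of_mem_span_fourier {p : C(UnitAddCircle, ℂ)}
    (hp : p ∈ Submodule.span ℂ (range (fourier (T := 1)))) :
    ∃ (s : Finset ℤ) (c : ℤ → ℂ), ∀ t, p t = ∑ x ∈ s, c x * fourier x t := by
  obtain ⟨c, rfl⟩ := Finsupp.mem_span_range_iff_exists_finsupp.1 hp
  refine ⟨c.support, c, fun t => ?_⟩
  simp [Finsupp.sum, ContinuousMap.sum_apply]

/-- Trigonometric polynomials are uniformly dense, by Stone–Weierstrass. -/
lemma forall_continuousMap_of_forall_trigPoly {P : C(UnitAddCircle, ℂ) → Prop}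
    (hclosed : IsClosed {p | P p})
    (h : ∀ (p : C(UnitAddCircle, ℂ)) (s : Finset ℤ) (c : ℤ → ℂ),
      (∀ t, p t = ∑ x ∈ s, c x * fourier x t) → P p) (p : C(UnitAddCircle, ℂ)) : P p := by
  have hp : p ∈ (Submodule.span ℂ (range (fourier (T := 1)))).topologicalClosure := by
    rw [span_fourier_closure_eq_top]
    trivial
  refine closure_minimal (fun q hq => ?_) hclosed hp
  obtain ⟨s, c, hc⟩ := exists_finset_of_mem_span_fourier hq
  exact h q s c hc

lemma continuous_integral_norm_sq (σ : Measure UnitAddCircle) [IsFiniteMeasure σ] :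
    Continuous fun p : C(UnitAddCircle, ℂ) => ∫ t, ‖p t‖ ^ 2 ∂σ := by
  refine continuous_iff_continuousAt.2 fun p => ?_
  refine continuousAt_of_dominated (bound := fun _ => (‖p‖ + 1) ^ 2)
    (Eventually.of_forall fun q => (by fun_prop : Continuous fun t => ‖q t‖ ^ 2).aestronglyMeasurable)
    ?_ (integrable_const _) (ae_of_all _ fun t => ?_)
  · filter_upwards [Metric.ball_mem_nhds p one_pos] with q hq
    refine ae_of_all _ fun t => ?_
    rw [norm_pow, norm_norm]
    have h1 : ‖q t‖ ≤ ‖q‖ := q.norm_coe_le_norm t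
    have h2 : ‖q‖ ≤ ‖p‖ + 1 := by
      have := norm_le_norm_add_norm_sub p q
      rw [Metric.mem_ball, dist_comm, dist_eq_norm] at hq
      linarith
    gcongr
    exact h1.trans h2
  · exact (by fun_prop : Continuous fun q : C(UnitAddCircle, ℂ) => ‖q t‖ ^ 2).continuousAt

/-- Thickened indicators carry the inequality to closed sets, and inner regularity carries it to
Borel sets. -/
lemma measure_le_of_forall_integral_le {α : Type*} [PseudoEMetricSpace α] [MeasurableSpace α]
    [BorelSpace α] {σ τ : Measure α} [IsFiniteMeasure σ] [IsFiniteMeasure τ]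
    (h : ∀ φ : C(α, ℝ), (∀ x, 0 ≤ φ x) → (∀ x, φ x ≤ 1) → ∫ x, φ x ∂σ ≤ ∫ x, φ x ∂τ) :
    σ ≤ τ := by
  have hF : ∀ F : Set α, IsClosed F → σ F ≤ τ F := by
    intro F hF
    have hδ : ∀ k : ℕ, (0 : ℝ) < 1 / (k + 1) := fun k => by positivity
    have h1 := tendsto_integral_thickenedIndicator_of_isClosed σ hF hδ
      tendsto_one_div_add_atTop_nhds_zero_nat
    have h2 := tendsto_integral_thickenedIndicator_of_isClosed τ hF hδ
      tendsto_one_div_add_atTop_nhds_zero_nat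
    have h3 := le_of_tendsto_of_tendsto' h1 h2 fun k =>
      h ⟨fun x => (thickenedIndicator (hδ k) F x : ℝ), by fun_prop⟩ (fun x => by simp) fun x =>
        by exact_mod_cast thickenedIndicator_le_one (hδ k) F x
    simp only [Measure.real] at h3
    exact (ENNReal.toReal_le_toReal (measure_ne_top _ _) (measure_ne_top _ _)).1 h3
  refine Measure.le_iff.2 fun B hB => ?_
  rw [hB.measure_eq_iSup_isClosed_of_ne_top (measure_ne_top _ _)]
  refine iSup_le fun K => iSup_le fun hKB => iSup_le fun hK => ?_
  exact (hF K hK).trans (measure_mono hKB)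

/-- The spectral measure of a sum is dominated by those of the summands. -/
lemma spectralMeasure_add_le {U : H ≃ₗᵢ[ℂ] H} {f g : H} {σ σ₁ σ₂ : Measure UnitAddCircle}
    (hσ : IsSpectralMeasure U (f + g) σ) (h₁ : IsSpectralMeasure U f σ₁)
    (h₂ : IsSpectralMeasure U g σ₂) : σ ≤ (2 : NNReal) • (σ₁ + σ₂) := by
  have := hσ.1
  have := h₁.1
  have := h₂.1
  -- For a trigonometric polynomial this is $\|u+v\|^2\le2(\|u\|^2+\|v\|^2)$ with $u=p(U)f$ and
  -- $v=p(U)g$. The choice $p=\sqrt\varphi$ below then compares the measures themselves.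
  have key : ∀ p : C(UnitAddCircle, ℂ), ∫ t, ‖p t‖ ^ 2 ∂σ ≤
      2 * (∫ t, ‖p t‖ ^ 2 ∂σ₁ + ∫ t, ‖p t‖ ^ 2 ∂σ₂) := by
    refine forall_continuousMap_of_forall_trigPoly (isClosed_le (continuous_integral_norm_sq σ)
      (((continuous_integral_norm_sq σ₁).add (continuous_integral_norm_sq σ₂)).const_mul 2)) ?_
    intro p s c hp
    simp_rw [hp]
    rw [integral_norm_sq_eq_of_isSpectralMeasure hσ s c fun x => x,
      integral_norm_sq_eq_of_isSpectralMeasure h₁ s c fun x => x,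
      integral_norm_sq_eq_of_isSpectralMeasure h₂ s c fun x => x]
    simp only [map_add, smul_add, Finset.sum_add_distrib]
    set u := ∑ x ∈ s, c x • (U ^ x) f
    set v := ∑ x ∈ s, c x • (U ^ x) g
    have h3 := norm_add_le u v
    have h4 := norm_nonneg (u + v)
    nlinarith [sq_nonneg (‖u‖ - ‖v‖)]
  refine measure_le_of_forall_integral_le fun φ hφ _ => ?_
  have e := key ⟨fun t => ((√(φ t) : ℝ) : ℂ), by fun_prop⟩
  have e2 : ∀ t, ‖((√(φ t) : ℝ) : ℂ)‖ ^ 2 = φ t := fun t => by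
    rw [Complex.norm_real, Real.norm_eq_abs, sq_abs, Real.sq_sqrt (hφ t)]
  simp only [ContinuousMap.coe_mk, e2] at e
  rw [integral_smul_nnreal_measure, integral_add_measure
    (integrable_of_continuous_circle _ φ.continuous)
    (integrable_of_continuous_circle _ φ.continuous)]
  simpa [NNReal.smul_def, mul_add] using e

lemma spectralMeasure_univ {U : H ≃ₗᵢ[ℂ] H} {f : H} {σ : Measure UnitAddCircle}
    (hσ : IsSpectralMeasure U f σ) : σ univ = ENNReal.ofReal (‖f‖ ^ 2) := by
  have := hσ.1
  have h := hσ.2 0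
  simp only [fourier_zero, integral_const, zpow_zero, LinearIsometryEquiv.coe_one, id_eq] at h
  rw [inner_self_eq_norm_sq_to_K] at h
  have h' : σ.real univ = ‖f‖ ^ 2 := by
    simp only [Complex.real_smul, mul_one] at h
    exact Complex.ofReal_injective (by simpa using h)
  rw [← h', ofReal_measureReal]

lemma IsSpectralMeasure.smul {U : H ≃ₗᵢ[ℂ] H} {f : H} {σ : Measure UnitAddCircle}
    (hσ : IsSpectralMeasure U f σ) (c : ℂ) :
    IsSpectralMeasure U (c • f) ((‖c‖₊ ^ 2) • σ) := by
  have := hσ.1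
  refine ⟨inferInstance, fun m => ?_⟩
  rw [integral_smul_nnreal_measure, hσ.2, map_smul, inner_smul_left, inner_smul_right,
    ← mul_assoc, Complex.conj_mul']
  simp [NNReal.smul_def]

/-- Spectral measures of the vectors of a span inherit properties of those of the generators. -/
lemma exists_isSpectralMeasure_of_mem_span [CompleteSpace H] {U : H ≃ₗᵢ[ℂ] H} {S : Set H}
    {P : Measure UnitAddCircle → Prop} (h0 : P 0) (hadd : ∀ σ τ, P σ → P τ → P (σ + τ))
    (hmono : ∀ σ τ (c : NNReal), P τ → σ ≤ c • τ → P σ)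
    (h : ∀ f ∈ S, ∀ σ, IsSpectralMeasure U f σ → P σ) {g : H} (hg : g ∈ Submodule.span ℂ S) :
    ∃ σ, IsSpectralMeasure U g σ ∧ P σ := by
  induction hg using Submodule.span_induction with
  | mem g hg =>
    obtain ⟨σ, hσ⟩ := exists_isSpectralMeasure U g
    exact ⟨σ, hσ, h g hg σ hσ⟩
  | zero =>
    obtain ⟨σ, hσ⟩ := exists_isSpectralMeasure U (0 : H)
    have : σ = 0 := Measure.measure_univ_eq_zero.1 (by simpa using spectralMeasure_univ hσ)
    exact ⟨σ, hσ, this ▸ h0⟩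
  | add x y _ _ hx hy =>
    obtain ⟨σ₁, h₁, hP₁⟩ := hx
    obtain ⟨σ₂, h₂, hP₂⟩ := hy
    obtain ⟨σ, hσ⟩ := exists_isSpectralMeasure U (x + y)
    exact ⟨σ, hσ, hmono _ _ 2 (hadd _ _ hP₁ hP₂) (spectralMeasure_add_le hσ h₁ h₂)⟩
  | smul c x _ hx =>
    obtain ⟨σ, hσ, hP⟩ := hx
    exact ⟨_, hσ.smul c, hmono _ _ _ hP le_rfl⟩

/-- For $g\in V$ close to $f$, write $f=g+(f-g)$: the spectral measure of $f-g$ has total mass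
$\|f-g\|^2$. In this way null sets of the measures of a dense subspace remain almost null for every
vector. -/
lemma exists_mem_spectralMeasure_le [CompleteSpace H] {U : H ≃ₗᵢ[ℂ] H} {V : Submodule ℂ H}
    (hV : V.topologicalClosure = ⊤) {f : H} {σ : Measure UnitAddCircle}
    (hσ : IsSpectralMeasure U f σ) {ε : ℝ} (hε : 0 < ε) :
    ∃ g ∈ V, ∀ τ, IsSpectralMeasure U g τ → ∀ B, σ B ≤ 2 * τ B + ENNReal.ofReal ε := by
  have hf : f ∈ closure (V : Set H) := by
    rw [← Submodule.topologicalClosure_coe, hV]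
    trivial
  have hpos : (0 : ℝ) < √(ε / 2) := Real.sqrt_pos.2 (by positivity)
  obtain ⟨g, hg, hfg⟩ := Metric.mem_closure_iff.1 hf _ hpos
  refine ⟨g, hg, fun τ hτ B => ?_⟩
  obtain ⟨τ', hτ'⟩ := exists_isSpectralMeasure U (f - g)
  have hle := spectralMeasure_add_le
    (by rwa [add_sub_cancel] : IsSpectralMeasure U (g + (f - g)) σ) hτ hτ' B
  have hnorm : 2 * ‖f - g‖ ^ 2 ≤ ε := by
    rw [dist_eq_norm] at hfg
    have := pow_le_pow_left₀ (norm_nonneg _) hfg.le 2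
    rw [Real.sq_sqrt (by positivity)] at this
    linarith
  calc σ B ≤ 2 * τ B + 2 * τ' B := by
        simpa [ENNReal.smul_def, mul_add] using hle
    _ ≤ 2 * τ B + 2 * τ' univ := by
        gcongr
        exact subset_univ B
    _ = 2 * τ B + ENNReal.ofReal (2 * ‖f - g‖ ^ 2) := by
        rw [spectralMeasure_univ hτ', ENNReal.ofReal_mul (by norm_num)]
        norm_num
    _ ≤ 2 * τ B + ENNReal.ofReal ε := by gcongr

/-- A unitary operator has absolutely continuous spectrum if the vectors of a total set have
absolutely continuous spectral measures. -/
theorem hasAbsolutelyContinuousSpectrum_of_total [CompleteSpace H] {U : H ≃ₗᵢ[ℂ] H} {S : Set H}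
    (hS : (Submodule.span ℂ S).topologicalClosure = ⊤)
    (h : ∀ f ∈ S, ∀ σ, IsSpectralMeasure U f σ → σ ≪ volume) :
    HasAbsolutelyContinuousSpectrum U := by
  intro f
  obtain ⟨σ, hσ⟩ := exists_isSpectralMeasure U f
  refine ⟨σ, hσ, fun B hB => ?_⟩
  refine le_antisymm (ENNReal.le_of_forall_pos_le_add fun ε hε _ => ?_) zero_le
  obtain ⟨g, hg, hle⟩ := exists_mem_spectralMeasure_le hS hσ (NNReal.coe_pos.2 hε)
  obtain ⟨τ, hτ, hac⟩ := exists_isSpectralMeasure_of_mem_span (P := fun τ => τ ≪ volume)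
    (Measure.AbsolutelyContinuous.zero _) (fun _ _ h₁ h₂ => h₁.add_left h₂)
    (fun _ _ c hP hle => hle.absolutelyContinuous.trans (hP.smul_left c)) h hg
  simpa [hac hB] using hle τ hτ B

/-- A unitary operator has singular spectrum if the vectors of a total set have singular spectral
measures. -/
theorem hasSingularSpectrum_of_total [CompleteSpace H] {U : H ≃ₗᵢ[ℂ] H} {S : Set H}
    (hS : (Submodule.span ℂ S).topologicalClosure = ⊤)
    (h : ∀ f ∈ S, ∀ σ, IsSpectralMeasure U f σ → σ ⟂ₘ volume) :
    HasSingularSpectrum U := by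
  intro f
  obtain ⟨σ, hσ⟩ := exists_isSpectralMeasure U f
  refine ⟨σ, hσ, mutuallySingular_of_forall_exists_measure_le fun ε hε => ?_⟩
  obtain ⟨g, hg, hle⟩ := exists_mem_spectralMeasure_le hS hσ hε
  obtain ⟨τ, hτ, N, -, hN, hNc⟩ := exists_isSpectralMeasure_of_mem_span
    (P := fun τ => τ ⟂ₘ volume) Measure.MutuallySingular.zero_left
    (fun _ _ h₁ h₂ => h₁.add_left h₂) (fun _ _ c hP hle => (hP.smul_nnreal c).mono hle le_rfl) h hg
  refine ⟨Nᶜ, by rw [hNc]; exact zero_le, ?_⟩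
  rw [compl_compl]
  simpa [hN] using hle τ hτ N

end Comparison

/-- A measure on the circle with square summable Fourier coefficients is absolutely continuous. -/
theorem absolutelyContinuous_volume_of_summable {σ : Measure UnitAddCircle} [IsFiniteMeasure σ]
    (h : Summable fun m : ℤ => ‖∫ t, fourier m t ∂σ‖ ^ 2) : σ ≪ volume := by
  set M := ∑' m : ℤ, ‖∫ t, fourier m t ∂σ‖ ^ 2 with hM
  have hM0 : 0 ≤ M := tsum_nonneg fun m => sq_nonneg _
  -- By Cauchy–Schwarz on the coefficients, integration against `σ` is bounded in the $L^2$ norm of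
  -- Lebesgue measure.
  have key : ∀ p : C(UnitAddCircle, ℂ),
      ‖∫ t, p t ∂σ‖ ^ 2 ≤ M * ∫ t : UnitAddCircle, ‖p t‖ ^ 2 := by
    have hcont : Continuous fun p : C(UnitAddCircle, ℂ) => ‖∫ t, p t ∂σ‖ ^ 2 := by
      have : Continuous fun p : C(UnitAddCircle, ℂ) => ∫ t, p t ∂σ := by
        refine continuous_iff_continuousAt.2 fun p => ?_
        refine continuousAt_of_dominated (bound := fun _ => ‖p‖ + 1)
          (Eventually.of_forall fun q => q.continuous.aestronglyMeasurable)
          ?_ (integrable_const _) (ae_of_all _ fun t => ?_)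
        · filter_upwards [Metric.ball_mem_nhds p one_pos] with q hq
          refine ae_of_all _ fun t => (q.norm_coe_le_norm t).trans ?_
          have := norm_le_norm_add_norm_sub p q
          rw [Metric.mem_ball, dist_comm, dist_eq_norm] at hq
          linarith
        · exact (by fun_prop : Continuous fun q : C(UnitAddCircle, ℂ) => q t).continuousAt
      fun_prop
    refine forall_continuousMap_of_forall_trigPoly (isClosed_le hcont
      ((continuous_integral_norm_sq volume).const_mul M)) ?_
    intro p s c hp
    have h1 : ∫ t : UnitAddCircle, ‖p t‖ ^ 2 = ∑ x ∈ s, ‖c x‖ ^ 2 := by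
      simp_rw [hp]
      have e := integral_norm_sq_trigPoly volume s c id
      have e' : ∀ x ∈ s, ∑ y ∈ s, starRingEnd ℂ (c x) * c y *
          ∫ t : UnitAddCircle, fourier (id y - id x) t = ((‖c x‖ ^ 2 : ℝ) : ℂ) := by
        intro x hx
        rw [Finset.sum_eq_single x]
        · rw [sub_self, integral_fourier_volume, if_pos rfl, Complex.conj_mul']
          simp
        · intro y hy hyx
          rw [integral_fourier_volume, if_neg (by simpa [sub_eq_zero] using hyx), mul_zero]
        · exact fun hx' => absurd hx hx'
      rw [Finset.sum_congr rfl e', ← Complex.ofReal_sum, Complex.ofReal_inj] at e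
      exact e
    have h2 : ∫ t, p t ∂σ = ∑ x ∈ s, c x * ∫ t, fourier x t ∂σ := by
      simp_rw [hp]
      rw [integral_finsetSum _ fun x _ => integrable_of_continuous_circle σ (by fun_prop)]
      exact Finset.sum_congr rfl fun x _ => integral_const_mul _ _
    rw [h1, h2]
    calc ‖∑ x ∈ s, c x * ∫ t, fourier x t ∂σ‖ ^ 2
        ≤ (∑ x ∈ s, ‖c x‖ * ‖∫ t, fourier x t ∂σ‖) ^ 2 := by
          gcongr
          refine (norm_sum_le _ _).trans (Finset.sum_le_sum fun x _ => (norm_mul _ _).le)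
      _ ≤ (∑ x ∈ s, ‖c x‖ ^ 2) * ∑ x ∈ s, ‖∫ t, fourier x t ∂σ‖ ^ 2 :=
          Finset.sum_mul_sq_le_sq_mul_sq _ _ _
      _ ≤ (∑ x ∈ s, ‖c x‖ ^ 2) * M := by
          gcongr
          exact h.sum_le_tsum s fun x _ => sq_nonneg _
      _ = _ := mul_comm _ _
  have hF : ∀ F : Set UnitAddCircle, IsClosed F → volume F = 0 → σ F = 0 := by
    intro F hF h0
    have hδ : ∀ k : ℕ, (0 : ℝ) < 1 / (k + 1) := fun k => by positivity
    have h1 := tendsto_integral_thickenedIndicator_of_isClosed σ hF hδ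
      tendsto_one_div_add_atTop_nhds_zero_nat
    have h2 := tendsto_integral_thickenedIndicator_of_isClosed volume hF hδ
      tendsto_one_div_add_atTop_nhds_zero_nat
    -- Since $0\le\varphi\le1$ gives $\varphi^2\le\varphi$, the limit is $\sigma(F)^2\le
    -- M\,\mathrm{vol}(F)$.
    have h3 := le_of_tendsto_of_tendsto' (h1.pow 2) (h2.const_mul M) fun k => by
      set φ : UnitAddCircle → ℝ := fun t => (thickenedIndicator (hδ k) F t : ℝ) with hφ
      have hφc : Continuous φ := by fun_prop
      have e := key ⟨fun t => (φ t : ℂ), by fun_prop⟩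
      simp only [ContinuousMap.coe_mk] at e
      rw [integral_complex_ofReal, Complex.norm_real, Real.norm_eq_abs, sq_abs] at e
      refine e.trans (mul_le_mul_of_nonneg_left ?_ hM0)
      refine integral_mono (integrable_of_continuous_circle _ (by fun_prop))
        (integrable_of_continuous_circle _ hφc) fun t => ?_
      have hb0 : 0 ≤ φ t := by simp [hφ]
      have hb1 : φ t ≤ 1 := NNReal.coe_le_one.2 (thickenedIndicator_le_one (hδ k) F t)
      simp only [Complex.norm_real, Real.norm_eq_abs, sq_abs]
      nlinarith
    have h4 : volume.real F = 0 := by simp [Measure.real, h0]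
    rw [h4, mul_zero] at h3
    have h5 : σ.real F = 0 := by nlinarith [sq_nonneg (σ.real F)]
    exact (measureReal_eq_zero_iff).1 h5
  refine Measure.AbsolutelyContinuous.mk fun B hB h0 => ?_
  rw [hB.measure_eq_iSup_isClosed_of_ne_top (measure_ne_top _ _)]
  simp only [ENNReal.iSup_eq_zero]
  exact fun K hKB hK => hF K hK (measure_mono_null hKB h0)

/-! ### Lacunarity of the column starts. -/

namespace RankOneParams

variable (P : RankOneParams)

/-- The heights of the columns with their spacers grow at least as a geometric progression of
ratio `4`, starting at twice the height of the tower. -/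
def IsLacunary (j : ℕ) : Prop :=
  P.height j ≤ P.s j 0 ∧
    ∀ i, i + 1 < P.r j → 4 * (P.height j + P.s j i) ≤ P.height j + P.s j (i + 1)

lemma exists_isLacunary (h : P.FastSpacers) : ∃ L, ∀ j, L ≤ j → P.IsLacunary j := by
  obtain ⟨⟨ψ, hψ, hs⟩, -⟩ := h
  -- The threshold $8$ absorbs the heights: $h\le s_i$ gives $4(h+s_i)\le8s_i\le s_{i+1}$.
  obtain ⟨L, hL⟩ := eventually_atTop.1 (hψ.eventually_ge_atTop 8)
  refine ⟨L, fun j hj => ?_⟩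
  have hψj := hL j hj
  have h0 : P.height j ≤ P.s j 0 := by
    have := (hs j).1
    have h1 : (0 : ℝ) ≤ P.height j := by positivity
    have : (P.height j : ℝ) ≤ P.s j 0 := by nlinarith
    exact_mod_cast this
  have hstep : ∀ i, i + 1 < P.r j → 8 * P.s j i ≤ P.s j (i + 1) := fun i hi => by
    have := (hs j).2 i hi
    have h1 : (0 : ℝ) ≤ P.s j i := by positivity
    have : (8 : ℝ) * P.s j i ≤ P.s j (i + 1) := by nlinarith
    exact_mod_cast this
  have hle : ∀ i, i < P.r j → P.height j ≤ P.s j i := by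
    intro i
    induction i with
    | zero => exact fun _ => h0
    | succ i ih =>
      intro hi
      have := ih (by omega)
      have := hstep i hi
      omega
  refine ⟨h0, fun i hi => ?_⟩
  have := hstep i hi
  have := hle i (by omega)
  omega

lemma lt_height (j : ℕ) : j < P.height j := by
  induction j with
  | zero => exact P.height_pos 0
  | succ j ih =>
    have := Nat.mul_le_mul_left (P.height j) (P.two_le_r j)
    simp only [height]
    omega

lemma height_mono : Monotone P.height := by
  refine monotone_nat_of_le_succ fun j => ?_
  have := Nat.mul_le_mul_left (P.height j) (P.two_le_r j)
  simp only [height]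
  omega

lemma colStart_eq_sum (j i : ℕ) :
    P.colStart j i = ∑ p ∈ Finset.range i, (P.height j + P.s j p) := by
  simp [colStart, Finset.sum_add_distrib]

variable {P}

namespace IsLacunary

variable {j : ℕ}

/-- Ratio $4$ leaves room for coefficients up to $3$. The margin $2h$ comes from $h\le s_j(0)$ and
persists under the induction. -/
lemma sum_le (h : P.IsLacunary j) : ∀ n, n < P.r j →
    3 * ∑ p ∈ Finset.range n, (P.height j + P.s j p) + 2 * P.height j ≤ P.height j + P.s j n := by
  intro n
  induction n with
  | zero => intro _; have := h.1; simp; omega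
  | succ n ih =>
    intro hn
    have h1 := ih (by omega)
    have h2 := h.2 n hn
    rw [Finset.sum_range_succ]
    omega

lemma height_le_last (h : P.IsLacunary j) : P.height j ≤ P.s j (P.r j - 1) := by
  have := h.sum_le (P.r j - 1) (by have := P.two_le_r j; omega)
  omega

/-- The last term with a nonzero coefficient would exceed all earlier ones together by at least
$2h$. -/
lemma eq_zero_of_abs_sum_lt (h : P.IsLacunary j) {ε : ℕ → ℤ}
    (hε : ∀ p, |ε p| ≤ 3) : ∀ n, n ≤ P.r j →
    |∑ p ∈ Finset.range n, ε p * ((P.height j + P.s j p : ℕ) : ℤ)| < 2 * P.height j →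
    ∀ p, p < n → ε p = 0 := by
  intro n
  induction n with
  | zero => intro _ _ p hp; omega
  | succ n ih =>
    intro hn hsum p hp
    have hle := h.sum_le n (by omega)
    have hrest : |∑ p ∈ Finset.range n, ε p * ((P.height j + P.s j p : ℕ) : ℤ)| ≤
        3 * ∑ p ∈ Finset.range n, ((P.height j + P.s j p : ℕ) : ℤ) := by
      rw [Finset.mul_sum]
      refine (Finset.abs_sum_le_sum_abs _ _).trans (Finset.sum_le_sum fun p _ => ?_)
      rw [abs_mul, Nat.abs_cast]
      exact mul_le_mul_of_nonneg_right (hε p) (by positivity)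
    have hle' : 3 * ∑ p ∈ Finset.range n, ((P.height j + P.s j p : ℕ) : ℤ) + 2 * P.height j ≤
        ((P.height j + P.s j n : ℕ) : ℤ) := by exact_mod_cast hle
    rw [Finset.sum_range_succ] at hsum
    have hn0 : ε n = 0 := by
      by_contra hne
      have h1 : 1 ≤ |ε n| := Int.one_le_abs hne
      have h2 : ((P.height j + P.s j n : ℕ) : ℤ) ≤ |ε n * ((P.height j + P.s j n : ℕ) : ℤ)| := by
        rw [abs_mul, Nat.abs_cast]
        nlinarith [Int.natCast_nonneg (P.height j + P.s j n)]
      have h3 := abs_sub_abs_le_abs_add (ε n * ((P.height j + P.s j n : ℕ) : ℤ))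
        (∑ p ∈ Finset.range n, ε p * ((P.height j + P.s j p : ℕ) : ℤ))
      rw [add_comm] at hsum
      linarith
    rw [hn0, zero_mul, add_zero] at hsum
    rcases Nat.lt_succ_iff_lt_or_eq.1 hp with hp' | rfl
    · exact ih (by omega) hsum p hp'
    · exact hn0

/-- Sums of three column starts determine their summands, even up to an error. -/
lemma count_eq_of_abs_lt (h : P.IsLacunary j) {a₁ a₂ a₃ b₁ b₂ b₃ : ℕ} (ha₁ : a₁ < P.r j)
    (ha₂ : a₂ < P.r j)
    (ha₃ : a₃ < P.r j) (hb₁ : b₁ < P.r j) (hb₂ : b₂ < P.r j) (hb₃ : b₃ < P.r j)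
    (hlt : |(P.colStart j a₁ + P.colStart j a₂ + P.colStart j a₃ : ℤ) -
      (P.colStart j b₁ + P.colStart j b₂ + P.colStart j b₃)| < 2 * P.height j) (x : ℕ) :
    ((if a₁ = x then 1 else 0) + (if a₂ = x then 1 else 0) + (if a₃ = x then 1 else 0) : ℤ) =
      (if b₁ = x then 1 else 0) + (if b₂ = x then 1 else 0) + (if b₃ = x then 1 else 0) := by
  -- A column start is the sum of $h+s_p$ over $p<a$, so `χ a` is its coefficient sequence. Three
  -- summands on each side keep the coefficients of the difference within $[-3,3]$.
  set χ : ℕ → ℕ → ℤ := fun a p => if p < a then 1 else 0 with hχ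
  have hχ01 : ∀ a p, 0 ≤ χ a p ∧ χ a p ≤ 1 := fun a p => by
    simp only [hχ]; split_ifs <;> omega
  have hc : ∀ a, a < P.r j → (P.colStart j a : ℤ) =
      ∑ p ∈ Finset.range (P.r j), χ a p * ((P.height j + P.s j p : ℕ) : ℤ) := by
    intro a ha
    rw [colStart_eq_sum, Nat.cast_sum]
    simp only [hχ, ite_mul, one_mul, zero_mul]
    rw [← Finset.sum_filter]
    refine Finset.sum_congr ?_ fun _ _ => rfl
    ext p
    simp only [Finset.mem_range, Finset.mem_filter]
    omega
  rw [hc _ ha₁, hc _ ha₂, hc _ ha₃, hc _ hb₁, hc _ hb₂, hc _ hb₃] at hlt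
  simp only [← Finset.sum_add_distrib, ← Finset.sum_sub_distrib, ← add_mul, ← sub_mul] at hlt
  have hzero := h.eq_zero_of_abs_sum_lt
    (ε := fun p => χ a₁ p + χ a₂ p + χ a₃ p - (χ b₁ p + χ b₂ p + χ b₃ p)) (fun p => by
      have := hχ01 a₁ p; have := hχ01 a₂ p; have := hχ01 a₃ p
      have := hχ01 b₁ p; have := hχ01 b₂ p; have := hχ01 b₃ p
      rw [abs_le]
      constructor <;> omega) _ le_rfl hlt
  have hall : ∀ p, χ a₁ p + χ a₂ p + χ a₃ p = χ b₁ p + χ b₂ p + χ b₃ p := by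
    intro p
    by_cases hp : p < P.r j
    · have := hzero p hp
      linarith
    · have : ∀ a, a < P.r j → χ a p = 0 := fun a ha => if_neg (by omega)
      rw [this _ ha₁, this _ ha₂, this _ ha₃, this _ hb₁, this _ hb₂, this _ hb₃]
  -- The indicator of $a=x$ is the drop of `χ a` at `x`, with the value $1$ understood before
  -- position $0$.
  cases x with
  | zero =>
    have hδ : ∀ a : ℕ, (if a = 0 then 1 else 0 : ℤ) = 1 - χ a 0 := fun a => by
      simp only [hχ]; split_ifs <;> omega
    have := hall 0
    simp only [hδ]
    linarith
  | succ x =>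
    have hδ : ∀ a : ℕ, (if a = x + 1 then 1 else 0 : ℤ) = χ a x - χ a (x + 1) := fun a => by
      simp only [hχ]; split_ifs <;> omega
    have := hall x
    have := hall (x + 1)
    simp only [hδ]
    linarith

/-- The differences of column starts are distinct, even up to an error. -/
lemma eq_of_abs_sub_lt (h : P.IsLacunary j) {i i' l l' : ℕ} (hi : i < P.r j) (hi' : i' < P.r j)
    (hl : l < P.r j)
    (hl' : l' < P.r j) (hne : i ≠ i')
    (hlt : |(P.colStart j i - P.colStart j i' : ℤ) - (P.colStart j l - P.colStart j l')| <
      2 * P.height j) : i = l ∧ i' = l' := by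
  -- Only two summands per side are needed; the third, `l'`, is a dummy that cancels.
  have key := h.count_eq_of_abs_lt hi hl' hl' hi' hl hl' (by
    convert hlt using 2
    ring)
  have h1 := key i
  have h2 := key i'
  simp only [if_true, hne, hne.symm, if_false] at h1 h2
  split_ifs at h1 h2 <;> omega

lemma two_mul_height_le (h : P.IsLacunary j) {i i' : ℕ} (hi : i < P.r j) (hi' : i' < P.r j)
    (hne : i ≠ i') :
    2 * (P.height j : ℤ) ≤ |(P.colStart j i - P.colStart j i' : ℤ)| := by
  by_contra hlt
  rw [not_le] at hlt
  -- Comparison with the zero difference of column `i` and itself.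
  have := h.eq_of_abs_sub_lt hi hi' hi hi hne (by simpa using hlt)
  omega

/-- A difference of two differences of column starts without common ends is not close to a
difference of column starts. -/
lemma height_le_of_ne (h : P.IsLacunary j) {i i' l l' a b : ℕ} (hi : i < P.r j)
    (hi' : i' < P.r j) (hl : l < P.r j)
    (hl' : l' < P.r j) (ha : a < P.r j) (hb : b < P.r j) (hil : i ≠ l) (hil' : i' ≠ l')
    (hii : i ≠ i') (hll : l ≠ l') (hi2 : i ≠ l') :
    (P.height j : ℤ) ≤ |(P.colStart j i - P.colStart j i' : ℤ) -
      (P.colStart j l - P.colStart j l') - (P.colStart j a - P.colStart j b)| := by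
  by_contra hlt
  rw [not_le] at hlt
  have hpos : (0 : ℤ) ≤ P.height j := by positivity
  have key := h.count_eq_of_abs_lt hi hl' hb hi' hl ha (by
    refine lt_of_eq_of_lt ?_ (lt_of_lt_of_le hlt (by linarith : (P.height j : ℤ) ≤ 2 * P.height j))
    congr 1
    ring)
  -- On the right-hand side both `i` and `l'` can occur only as `a`, which cannot equal both.
  have h1 := key i
  have h2 := key l'
  simp only [if_true, hil.symm, hil', hii.symm, hll, hi2, hi2.symm, if_false] at h1 h2
  split_ifs at h1 h2 <;> omega

end IsLacunary

/-! ### The recursion for the correlations. -/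

lemma abs_colStart_sub_add_le {j i i' : ℕ} (hi : i < P.r j) (hi' : i' < P.r j) :
    |(P.colStart j i - P.colStart j i' : ℤ)| + P.height j ≤ P.height (j + 1) := by
  have h1 : ∀ i, i < P.r j → P.colStart j i + P.height j ≤ P.height (j + 1) := fun i hi => by
    have h := P.colStart_mono j (Nat.succ_le_of_lt hi)
    rw [Nat.succ_eq_add_one, colStart_succ] at h
    rw [height_succ]
    omega
  have := h1 i hi
  have := h1 i' hi'
  have : |(P.colStart j i - P.colStart j i' : ℤ)| ≤ (P.height (j + 1) : ℤ) - P.height j := by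
    rw [abs_le]
    constructor <;> omega
  linarith

variable (P)

/-- The normalized correlations at the stage `L + d` of the copies of the base of stage `L`. -/
noncomputable def stageCorr (L : ℕ) : ℕ → ℤ → ℝ
  | 0, m => if m = 0 then 1 else 0
  | d + 1, m => (∑ i ∈ Finset.range (P.r (L + d)), ∑ i' ∈ Finset.range (P.r (L + d)),
      stageCorr L d (m - (P.colStart (L + d) i - P.colStart (L + d) i'))) / P.r (L + d)

lemma stageCorr_nonneg (L d : ℕ) (m : ℤ) : 0 ≤ P.stageCorr L d m := by
  induction d generalizing m with
  | zero => simp only [stageCorr]; split_ifs <;> norm_num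
  | succ d ih =>
    simp only [stageCorr]
    exact div_nonneg (Finset.sum_nonneg fun i _ => Finset.sum_nonneg fun i' _ => ih _)
      (by positivity)

lemma stageCorr_neg (L d : ℕ) (m : ℤ) : P.stageCorr L d (-m) = P.stageCorr L d m := by
  induction d generalizing m with
  | zero => simp [stageCorr]
  | succ d ih =>
    simp only [stageCorr]
    rw [Finset.sum_comm]
    congr 1
    refine Finset.sum_congr rfl fun i _ => Finset.sum_congr rfl fun i' _ => ?_
    rw [← ih]
    congr 1
    ring

lemma stageCorr_eq_zero (L d : ℕ) {m : ℤ} (hm : (P.height (L + d) : ℤ) ≤ |m|) :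
    P.stageCorr L d m = 0 := by
  induction d generalizing m with
  | zero =>
    have := P.height_pos (L + 0)
    simp only [stageCorr]
    refine if_neg ?_
    rintro rfl
    rw [abs_zero] at hm
    omega
  | succ d ih =>
    simp only [stageCorr]
    rw [Finset.sum_eq_zero, zero_div]
    intro i hi
    refine Finset.sum_eq_zero fun i' hi' => ih ?_
    have h1 := abs_colStart_sub_add_le (Finset.mem_range.1 hi) (Finset.mem_range.1 hi')
    have h2 := abs_sub_abs_le_abs_sub m (P.colStart (L + d) i - P.colStart (L + d) i')
    rw [← add_assoc] at hm
    linarith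

variable {P} {L : ℕ}

lemma stageCorr_succ_eq_zero {d : ℕ} {m : ℤ}
    (hm : ∀ a b, a < P.r (L + d) → b < P.r (L + d) → (P.height (L + d) : ℤ) ≤
      |m - (P.colStart (L + d) a - P.colStart (L + d) b)|) : P.stageCorr L (d + 1) m = 0 := by
  simp only [stageCorr]
  rw [Finset.sum_eq_zero, zero_div]
  intro i hi
  exact Finset.sum_eq_zero fun i' hi' => P.stageCorr_eq_zero L d
    (hm i i' (Finset.mem_range.1 hi) (Finset.mem_range.1 hi'))

/-- The off-diagonal terms are displaced by at least $2h$ and leave the support; the $r$ diagonal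
terms are equal and cancel the normalization. -/
lemma stageCorr_succ (hL : ∀ j, L ≤ j → P.IsLacunary j) {d : ℕ} {m : ℤ} (hm : |m| < P.height
    (L + d)) :
    P.stageCorr L (d + 1) m = P.stageCorr L d m := by
  have hr : (P.r (L + d) : ℝ) ≠ 0 := by
    have := P.two_le_r (L + d)
    positivity
  simp only [stageCorr]
  rw [div_eq_iff hr, mul_comm]
  have : ∀ i ∈ Finset.range (P.r (L + d)), ∑ i' ∈ Finset.range (P.r (L + d)),
      P.stageCorr L d (m - (P.colStart (L + d) i - P.colStart (L + d) i')) =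
        P.stageCorr L d m := by
    intro i hi
    rw [Finset.sum_eq_single i]
    · simp
    · intro i' hi' hne
      refine P.stageCorr_eq_zero L d ?_
      have h1 := (hL (L + d) (by omega)).two_mul_height_le (Finset.mem_range.1 hi)
        (Finset.mem_range.1 hi') hne.symm
      have h2 := abs_sub_abs_le_abs_sub (P.colStart (L + d) i - P.colStart (L + d) i' : ℤ) m
      rw [abs_sub_comm _ m] at h2
      linarith
    · exact fun h => absurd hi h
  rw [Finset.sum_congr rfl this]
  simp

/-- Distinct differences of column starts are $2h$ apart while the correlation of stage `L + d`
lives on $|x|<h$, so only the term of $(i,i')$ survives. -/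
lemma stageCorr_shift (hL : ∀ j, L ≤ j → P.IsLacunary j) {d i i' : ℕ} (hi : i < P.r (L + d))
    (hi' : i' < P.r (L + d)) (hne : i ≠ i')
    {x : ℤ} (hx : |x| < P.height (L + d)) :
    P.stageCorr L (d + 1) (P.colStart (L + d) i - P.colStart (L + d) i' + x) =
      P.stageCorr L d x / P.r (L + d) := by
  have hfar : ∀ l l', l < P.r (L + d) → l' < P.r (L + d) → ¬(l = i ∧ l' = i') →
      P.stageCorr L d (P.colStart (L + d) i - P.colStart (L + d) i' + x -
        (P.colStart (L + d) l - P.colStart (L + d) l')) = 0 := by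
    intro l l' hl hl' hll
    refine P.stageCorr_eq_zero L d ?_
    by_contra hlt
    rw [not_le] at hlt
    have h1 := (hL (L + d) (by omega)).eq_of_abs_sub_lt hi hi' hl hl' hne (by
      rw [abs_lt] at hx hlt ⊢
      constructor <;> linarith)
    exact hll ⟨h1.1.symm, h1.2.symm⟩
  simp only [stageCorr]
  congr 1
  rw [Finset.sum_eq_single i, Finset.sum_eq_single i']
  · congr 1
    ring
  · intro l' hl' hne'
    exact hfar i l' hi (Finset.mem_range.1 hl') (by omega)
  · exact fun h => absurd (Finset.mem_range.2 hi') h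
  · intro l hl hne'
    exact Finset.sum_eq_zero fun l' hl' => hfar l l' (Finset.mem_range.1 hl)
      (Finset.mem_range.1 hl') (by omega)
  · exact fun h => absurd (Finset.mem_range.2 hi) h

lemma stageCorr_add (hL : ∀ j, L ≤ j → P.IsLacunary j) {d : ℕ} (e : ℕ) {m : ℤ}
    (hm : |m| < P.height (L + d)) :
    P.stageCorr L (d + e) m = P.stageCorr L d m := by
  induction e with
  | zero => rfl
  | succ e ih =>
    rw [← add_assoc, stageCorr_succ hL, ih]
    have : P.height (L + d) ≤ P.height (L + (d + e)) := P.height_mono (by omega)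
    omega

variable (P) in
/-- The normalized correlations of the base of stage `L`. -/
noncomputable def corr (L : ℕ) (m : ℤ) : ℝ := P.stageCorr L m.natAbs m

/-- Stage correlations at `m` stop changing once the height exceeds $|m|$. The index `m.natAbs` in
`corr` is merely one that is large enough, by `lt_height`. -/
lemma corr_eq (hL : ∀ j, L ≤ j → P.IsLacunary j) {d : ℕ} {m : ℤ} (hm : |m| < P.height (L + d)) :
    P.corr L m = P.stageCorr L d m := by
  have h1 : |m| < P.height (L + m.natAbs) := by
    have := P.lt_height (L + m.natAbs)
    rw [Int.abs_eq_natAbs]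
    omega
  rw [corr, ← stageCorr_add hL d h1, add_comm, stageCorr_add hL _ hm]

lemma corr_nonneg (m : ℤ) : 0 ≤ P.corr L m := P.stageCorr_nonneg _ _ _

lemma corr_neg (m : ℤ) : P.corr L (-m) = P.corr L m := by
  rw [corr, Int.natAbs_neg, stageCorr_neg, corr]

lemma corr_zero : P.corr L 0 = 1 := by simp [corr, stageCorr]

lemma corr_shift (hL : ∀ j, L ≤ j → P.IsLacunary j) {d i i' : ℕ} (hi : i < P.r (L + d))
    (hi' : i' < P.r (L + d)) (hne : i ≠ i')
    {x : ℤ} (hx : |x| < P.height (L + d)) :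
    P.corr L (P.colStart (L + d) i - P.colStart (L + d) i' + x) =
      P.corr L x / P.r (L + d) := by
  have h1 : |(P.colStart (L + d) i - P.colStart (L + d) i' : ℤ) + x| <
      P.height (L + (d + 1)) := by
    have h := abs_colStart_sub_add_le hi hi'
    rw [← add_assoc]
    exact (abs_add_le _ _).trans_lt (by linarith)
  rw [corr_eq hL h1, stageCorr_shift hL hi hi' hne hx, corr_eq hL hx]

lemma corr_colStart_sub (hL : ∀ j, L ≤ j → P.IsLacunary j) {d i i' : ℕ} (hi : i < P.r (L + d))
    (hi' : i' < P.r (L + d))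
    (hne : i ≠ i') :
    P.corr L (P.colStart (L + d) i - P.colStart (L + d) i') = 1 / P.r (L + d) := by
  have h := corr_shift hL hi hi' hne (x := 0)
    (by rw [abs_zero]; exact_mod_cast P.height_pos (L + d))
  rwa [add_zero, corr_zero] at h

end RankOneParams

/-! ### Summability of powers of the correlations. -/

namespace RankOneParams

variable {P : RankOneParams} {L : ℕ}

/-- At most one translate reaches `m`: either `m` is near $0$, or it is near one difference of
column starts, or the correlation vanishes. So no cross terms arise in the power of the sum. -/
lemma stageCorr_succ_pow_le (hL : ∀ j, L ≤ j → P.IsLacunary j) (d : ℕ) {k : ℕ} (hk : k ≠ 0)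
    (m : ℤ) :
    P.stageCorr L (d + 1) m ^ k ≤ P.stageCorr L d m ^ k +
      (∑ i ∈ Finset.range (P.r (L + d)), ∑ i' ∈ Finset.range (P.r (L + d)),
        P.stageCorr L d (m - (P.colStart (L + d) i - P.colStart (L + d) i')) ^ k) /
          (P.r (L + d) : ℝ) ^ k := by
  have hnn : ∀ x, 0 ≤ P.stageCorr L d x ^ k := fun x => pow_nonneg (P.stageCorr_nonneg _ _ _) _
  have hsum : 0 ≤ (∑ i ∈ Finset.range (P.r (L + d)), ∑ i' ∈ Finset.range (P.r (L + d)),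
      P.stageCorr L d (m - (P.colStart (L + d) i - P.colStart (L + d) i')) ^ k) /
        (P.r (L + d) : ℝ) ^ k :=
    div_nonneg (Finset.sum_nonneg fun i _ => Finset.sum_nonneg fun i' _ => hnn _) (by positivity)
  by_cases hm : |m| < P.height (L + d)
  · rw [stageCorr_succ hL hm]
    linarith
  by_cases hex : ∃ a b, a < P.r (L + d) ∧ b < P.r (L + d) ∧
      |m - (P.colStart (L + d) a - P.colStart (L + d) b)| < P.height (L + d)
  · obtain ⟨a, b, ha, hb, hab⟩ := hex
    have hne : a ≠ b := by
      rintro rfl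
      simp only [sub_self, sub_zero] at hab
      exact hm hab
    have e := stageCorr_shift hL ha hb hne hab
    rw [add_sub_cancel] at e
    rw [e, div_pow]
    refine le_trans ?_ (le_add_of_nonneg_left (hnn m))
    gcongr
    refine le_trans ?_ (Finset.single_le_sum
      (f := fun i => ∑ i' ∈ Finset.range (P.r (L + d)),
        P.stageCorr L d (m - (P.colStart (L + d) i - P.colStart (L + d) i')) ^ k)
      (fun i _ => Finset.sum_nonneg fun i' _ => hnn _) (Finset.mem_range.2 ha))
    exact Finset.single_le_sum
      (f := fun i' => P.stageCorr L d (m - (P.colStart (L + d) a - P.colStart (L + d) i')) ^ k)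
      (fun i _ => hnn _) (Finset.mem_range.2 hb)
  · push Not at hex
    rw [stageCorr_succ_eq_zero hex, zero_pow hk]
    exact add_nonneg (hnn m) hsum

/-- Each of the $r^2$ translates contributes at most the previous bound divided by $r^k$. The bound
is uniform in `F` so that the induction hypothesis applies to translates of `F`. -/
lemma sum_stageCorr_pow_le (hL : ∀ j, L ≤ j → P.IsLacunary j) {k : ℕ} (hk : k ≠ 0) (d : ℕ)
    (F : Finset ℤ) :
    ∑ m ∈ F, P.stageCorr L d m ^ k ≤
      ∏ e ∈ Finset.range d, (1 + (P.r (L + e) : ℝ) ^ 2 / (P.r (L + e) : ℝ) ^ k) := by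
  induction d generalizing F with
  | zero =>
    simp only [stageCorr, Finset.range_zero, Finset.prod_empty, ite_pow, one_pow, zero_pow hk]
    rw [Finset.sum_ite_eq']
    split_ifs <;> norm_num
  | succ d ih =>
    rw [Finset.prod_range_succ]
    set B := ∏ e ∈ Finset.range d, (1 + (P.r (L + e) : ℝ) ^ 2 / (P.r (L + e) : ℝ) ^ k)
    have hshift : ∀ D : ℤ, ∑ m ∈ F, P.stageCorr L d (m - D) ^ k ≤ B := fun D => by
      refine le_of_eq_of_le ?_ (ih (F.map (Equiv.subRight D).toEmbedding))
      rw [Finset.sum_map]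
      rfl
    calc ∑ m ∈ F, P.stageCorr L (d + 1) m ^ k
        ≤ ∑ m ∈ F, (P.stageCorr L d m ^ k +
          (∑ i ∈ Finset.range (P.r (L + d)), ∑ i' ∈ Finset.range (P.r (L + d)),
            P.stageCorr L d (m - (P.colStart (L + d) i - P.colStart (L + d) i')) ^ k) /
              (P.r (L + d) : ℝ) ^ k) :=
          Finset.sum_le_sum fun m _ => stageCorr_succ_pow_le hL d hk m
      _ = ∑ m ∈ F, P.stageCorr L d m ^ k +
          (∑ i ∈ Finset.range (P.r (L + d)), ∑ i' ∈ Finset.range (P.r (L + d)), ∑ m ∈ F,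
            P.stageCorr L d (m - (P.colStart (L + d) i - P.colStart (L + d) i')) ^ k) /
              (P.r (L + d) : ℝ) ^ k := by
          rw [Finset.sum_add_distrib, ← Finset.sum_div, Finset.sum_comm]
          congr 2
          exact Finset.sum_congr rfl fun i _ => Finset.sum_comm
      _ ≤ B + (∑ i ∈ Finset.range (P.r (L + d)), ∑ i' ∈ Finset.range (P.r (L + d)), B) /
              (P.r (L + d) : ℝ) ^ k := by
          gcongr
          · exact ih F
          · exact hshift _
      _ = B * (1 + (P.r (L + d) : ℝ) ^ 2 / (P.r (L + d) : ℝ) ^ k) := by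
          simp only [Finset.sum_const, Finset.card_range, nsmul_eq_mul]
          ring

/-- By $1+x\le e^x$, the products of `sum_stageCorr_pow_le` are bounded by the exponential of the
series. -/
lemma summable_corr_pow (hL : ∀ j, L ≤ j → P.IsLacunary j) {k : ℕ} (hk : k ≠ 0)
    (h : Summable fun j => (P.r j : ℝ) ^ 2 / (P.r j : ℝ) ^ k) :
    Summable fun m => P.corr L m ^ k := by
  have h' : Summable fun e => (P.r (L + e) : ℝ) ^ 2 / (P.r (L + e) : ℝ) ^ k := by
    have := (summable_nat_add_iff L).2 h
    simpa only [add_comm] using this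
  refine summable_of_sum_le (c := Real.exp (∑' e, (P.r (L + e) : ℝ) ^ 2 / (P.r (L + e) : ℝ) ^ k))
    (fun m => pow_nonneg (corr_nonneg m) k) fun F => ?_
  set d := F.sup Int.natAbs with hd
  have hF : ∑ m ∈ F, P.corr L m ^ k = ∑ m ∈ F, P.stageCorr L d m ^ k := by
    refine Finset.sum_congr rfl fun m hm => ?_
    rw [corr_eq hL (d := d)]
    have h1 : m.natAbs ≤ d := Finset.le_sup (f := Int.natAbs) hm
    have h2 := P.lt_height (L + d)
    rw [Int.abs_eq_natAbs]
    omega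
  rw [hF]
  refine (sum_stageCorr_pow_le hL hk d F).trans ?_
  calc ∏ e ∈ Finset.range d, (1 + (P.r (L + e) : ℝ) ^ 2 / (P.r (L + e) : ℝ) ^ k)
      ≤ ∏ e ∈ Finset.range d, Real.exp ((P.r (L + e) : ℝ) ^ 2 / (P.r (L + e) : ℝ) ^ k) := by
        refine Finset.prod_le_prod (fun e _ => by positivity) fun e _ => ?_
        rw [add_comm]
        exact Real.add_one_le_exp _
    _ = Real.exp (∑ e ∈ Finset.range d, (P.r (L + e) : ℝ) ^ 2 / (P.r (L + e) : ℝ) ^ k) :=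
        (Real.exp_sum _ _).symm
    _ ≤ _ := Real.exp_le_exp.2 (h'.sum_le_tsum _ fun e _ => by positivity)

lemma sum_range_blocks {ν : ℝ} {J : ℕ → ℕ}
    (hconst : ∀ k j, J k ≤ j → j < J (k + 1) → P.r j = P.r (J k))
    (hstep : ∀ k, J (k + 1) = J k + ⌊(P.r (J k) : ℝ) ^ ν⌋₊) (g : ℕ → ℝ) (k : ℕ) :
    ∑ j ∈ Finset.range (J k), g (P.r j) = ∑ j ∈ Finset.range (J 0), g (P.r j) +
      ∑ l ∈ Finset.range k, (⌊(P.r (J l) : ℝ) ^ ν⌋₊ : ℝ) * g (P.r (J l)) := by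
  induction k with
  | zero => simp
  | succ k ih =>
    have : ∀ x ∈ Finset.range ⌊(P.r (J k) : ℝ) ^ ν⌋₊, g (P.r (J k + x)) = g (P.r (J k)) := by
      intro x hx
      rw [hconst k (J k + x) (by omega) (by
        rw [hstep]
        have := Finset.mem_range.1 hx
        omega)]
    rw [Finset.sum_range_succ, ← add_assoc, ← ih, hstep, Finset.sum_range_add,
      Finset.sum_congr rfl this]
    simp

/-- A block contributes at most $r^\nu r^{2-2n}=r^{-\delta}$ with $\delta=2n-2-\nu>0$, and the
growth condition sums these. -/
lemma summable_sq_div_pow {ν : ℝ} (hP : P.ColumnGrowth ν) {n : ℕ} (hn : ν < 2 * (n : ℝ) - 2) :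
    Summable fun j => (P.r j : ℝ) ^ 2 / (P.r j : ℝ) ^ (2 * n) := by
  obtain ⟨J, hJ, hsum, hconst, hstep⟩ := hP
  have hδ := hsum (2 * n - 2 - ν) (by linarith)
  refine summable_of_sum_range_le (c := ∑ j ∈ Finset.range (J 0),
    (P.r j : ℝ) ^ 2 / (P.r j : ℝ) ^ (2 * n) + ∑' k, (P.r (J k) : ℝ) ^ (-(2 * n - 2 - ν) : ℝ))
    (fun j => by positivity) fun N => ?_
  obtain ⟨k, hk⟩ := (hJ.eventually_ge_atTop N).exists
  have hterm : ∀ l, (⌊(P.r (J l) : ℝ) ^ ν⌋₊ : ℝ) *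
      ((P.r (J l) : ℝ) ^ 2 / (P.r (J l) : ℝ) ^ (2 * n)) ≤
        (P.r (J l) : ℝ) ^ (-(2 * n - 2 - ν) : ℝ) := by
    intro l
    have hr : (0 : ℝ) < P.r (J l) := by
      have := P.two_le_r (J l)
      positivity
    have e : (P.r (J l) : ℝ) ^ (-(2 * n - 2 - ν) : ℝ) =
        (P.r (J l) : ℝ) ^ ν * ((P.r (J l) : ℝ) ^ 2 / (P.r (J l) : ℝ) ^ (2 * n)) := by
      rw [← Real.rpow_natCast _ 2, ← Real.rpow_natCast _ (2 * n), ← Real.rpow_sub hr,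
        ← Real.rpow_add hr]
      congr 1
      push_cast
      ring
    rw [e]
    gcongr
    exact Nat.floor_le (by positivity)
  calc ∑ j ∈ Finset.range N, (P.r j : ℝ) ^ 2 / (P.r j : ℝ) ^ (2 * n)
      ≤ ∑ j ∈ Finset.range (J k), (P.r j : ℝ) ^ 2 / (P.r j : ℝ) ^ (2 * n) :=
        Finset.sum_le_sum_of_subset_of_nonneg (Finset.range_mono hk) fun j _ _ => by positivity
    _ = _ := sum_range_blocks hconst hstep (fun r => (r : ℝ) ^ 2 / (r : ℝ) ^ (2 * n)) k
    _ ≤ _ := by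
        gcongr
        exact (Finset.sum_le_sum fun l _ => hterm l).trans
          (hδ.sum_le_tsum _ fun l _ => by positivity)

/-- The integer $r^{2n-2}$ does not exceed $r^\nu$, hence not its floor either, so every block
contributes at least $1$. -/
lemma not_summable_sq_div_pow {ν : ℝ} (hP : P.ColumnGrowth ν) {n : ℕ} (hn1 : 1 ≤ n)
    (hn : 2 * (n : ℝ) - 2 ≤ ν) :
    ¬ Summable fun j => (P.r j : ℝ) ^ 2 / (P.r j : ℝ) ^ (2 * n) := by
  obtain ⟨J, hJ, -, hconst, hstep⟩ := hP
  intro hs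
  have hterm : ∀ l, 1 ≤ (⌊(P.r (J l) : ℝ) ^ ν⌋₊ : ℝ) *
      ((P.r (J l) : ℝ) ^ 2 / (P.r (J l) : ℝ) ^ (2 * n)) := by
    intro l
    have hr1 : (1 : ℝ) ≤ P.r (J l) := by
      have := P.two_le_r (J l)
      exact_mod_cast (by omega : 1 ≤ P.r (J l))
    have hr : (0 : ℝ) < P.r (J l) := by linarith
    have hfl : P.r (J l) ^ (2 * n - 2) ≤ ⌊(P.r (J l) : ℝ) ^ ν⌋₊ := by
      refine Nat.le_floor ?_
      push_cast
      rw [← Real.rpow_natCast]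
      refine Real.rpow_le_rpow_of_exponent_le hr1 ?_
      rw [Nat.cast_sub (by omega)]
      push_cast
      exact hn
    have hfl' : (P.r (J l) : ℝ) ^ (2 * n - 2) ≤ (⌊(P.r (J l) : ℝ) ^ ν⌋₊ : ℝ) := by
      exact_mod_cast hfl
    rw [← mul_div_assoc, le_div_iff₀ (by positivity), one_mul]
    calc (P.r (J l) : ℝ) ^ (2 * n) = (P.r (J l) : ℝ) ^ (2 * n - 2) * (P.r (J l) : ℝ) ^ 2 := by
          rw [← pow_add]
          congr 1
          omega
      _ ≤ _ := by gcongr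
  set M := ∑' j, (P.r j : ℝ) ^ 2 / (P.r j : ℝ) ^ (2 * n)
  obtain ⟨k, hk⟩ := exists_nat_gt M
  have h1 := hs.sum_le_tsum (Finset.range (J k)) fun j _ => by positivity
  rw [sum_range_blocks hconst hstep (fun r => (r : ℝ) ^ 2 / (r : ℝ) ^ (2 * n)) k] at h1
  have h2 : (k : ℝ) ≤ ∑ l ∈ Finset.range k, (⌊(P.r (J l) : ℝ) ^ ν⌋₊ : ℝ) *
      ((P.r (J l) : ℝ) ^ 2 / (P.r (J l) : ℝ) ^ (2 * n)) := by
    have := Finset.sum_le_sum (s := Finset.range k) fun l _ => hterm l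
    simpa using this
  have h3 : 0 ≤ ∑ j ∈ Finset.range (J 0), (P.r j : ℝ) ^ 2 / (P.r j : ℝ) ^ (2 * n) :=
    Finset.sum_nonneg fun j _ => by positivity
  linarith

end RankOneParams

/-! ### Trigonometric polynomials close to `1` in the divergent case. -/

namespace RankOneParams

variable {P : RankOneParams} {L : ℕ}

variable (P) in
/-- Pairs of columns of stage `j`: the first one in the upper half, the second in the lower. -/
def halfPairs (j : ℕ) : Finset (ℕ × ℕ) :=
  Finset.Ico (P.r j / 2) (2 * (P.r j / 2)) ×ˢ Finset.range (P.r j / 2)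

lemma mem_halfPairs {j : ℕ} {q : ℕ × ℕ} (hq : q ∈ P.halfPairs j) :
    q.1 < P.r j ∧ q.2 < P.r j / 2 ∧ P.r j / 2 ≤ q.1 := by
  simp only [halfPairs, Finset.mem_product, Finset.mem_Ico, Finset.mem_range] at hq
  omega

lemma card_halfPairs (j : ℕ) : (P.halfPairs j).card = (P.r j / 2) ^ 2 := by
  simp only [halfPairs, Finset.card_product, Nat.card_Ico, Finset.card_range]
  rw [sq]
  congr 1
  omega

variable (P L) in
/-- The distance between the two columns of a pair at stage `L + d`. -/
def pairShift (x : (_ : ℕ) × (ℕ × ℕ)) : ℤ :=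
  P.colStart (L + x.1) x.2.1 - P.colStart (L + x.1) x.2.2

lemma abs_pairShift_lt {x : (_ : ℕ) × (ℕ × ℕ)} (hx : x.2 ∈ P.halfPairs (L + x.1)) :
    |P.pairShift L x| < P.height (L + (x.1 + 1)) := by
  obtain ⟨h1, h2, h3⟩ := mem_halfPairs hx
  have h := abs_colStart_sub_add_le h1 (show x.2.2 < P.r (L + x.1) by omega)
  have := P.height_pos (L + x.1)
  rw [← add_assoc, pairShift]
  omega

lemma corr_pairShift (hL : ∀ j, L ≤ j → P.IsLacunary j) {x : (_ : ℕ) × (ℕ × ℕ)}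
    (hx : x.2 ∈ P.halfPairs (L + x.1)) : P.corr L (P.pairShift L x) = 1 / P.r (L + x.1) := by
  obtain ⟨h1, h2, h3⟩ := mem_halfPairs hx
  exact corr_colStart_sub hL h1 (by omega) (by omega)

/-- For the later stage the earlier shift is a small displacement, so `corr_shift` factorizes the
correlation as for independent variables. -/
lemma corr_pairShift_sub_of_lt (hL : ∀ j, L ≤ j → P.IsLacunary j) {x y : (_ : ℕ) × (ℕ × ℕ)}
    (hx : x.2 ∈ P.halfPairs (L + x.1)) (hy : y.2 ∈ P.halfPairs (L + y.1)) (hlt : x.1 < y.1) :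
    P.corr L (P.pairShift L y - P.pairShift L x) =
      1 / P.r (L + x.1) * (1 / P.r (L + y.1)) := by
  obtain ⟨h1, h2, h3⟩ := mem_halfPairs hy
  have hsmall : |-P.pairShift L x| < P.height (L + y.1) := by
    rw [abs_neg]
    refine (abs_pairShift_lt hx).trans_le ?_
    exact_mod_cast P.height_mono (by omega)
  have e := corr_shift hL h1 (show y.2.2 < P.r (L + y.1) by omega) (by omega) hsmall
  rw [corr_neg, corr_pairShift hL hx] at e
  rw [sub_eq_add_neg, pairShift, e]
  ring

lemma corr_pairShift_sub_of_ne (hL : ∀ j, L ≤ j → P.IsLacunary j) {x y : (_ : ℕ) × (ℕ × ℕ)}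
    (hx : x.2 ∈ P.halfPairs (L + x.1)) (hy : y.2 ∈ P.halfPairs (L + y.1)) (hne : x.1 ≠ y.1) :
    P.corr L (P.pairShift L y - P.pairShift L x) =
      1 / P.r (L + x.1) * (1 / P.r (L + y.1)) := by
  rcases lt_or_gt_of_ne hne with h | h
  · exact corr_pairShift_sub_of_lt hL hx hy h
  · rw [← corr_neg, neg_sub, corr_pairShift_sub_of_lt hL hy hx h, mul_comm]

/-- Pairs without a common end are uncorrelated by `height_le_of_ne`; one common end cancels and
leaves a difference of two column starts, with correlation $1/r$. -/
lemma corr_pairShift_sub_pow_le (hL : ∀ j, L ≤ j → P.IsLacunary j) {d : ℕ} {q q' : ℕ × ℕ}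
    (hq : q ∈ P.halfPairs (L + d)) (hq' : q' ∈ P.halfPairs (L + d)) {n : ℕ} (hn : n ≠ 0) :
    P.corr L (P.pairShift L ⟨d, q'⟩ - P.pairShift L ⟨d, q⟩) ^ n ≤
      (if q' = q then 1 else 0) + ((if q'.1 = q.1 then 1 else 0) + (if q'.2 = q.2 then 1 else 0)) *
        (1 / (P.r (L + d) : ℝ)) ^ n := by
  obtain ⟨h1, h2, h3⟩ := mem_halfPairs hq
  obtain ⟨h1', h2', h3'⟩ := mem_halfPairs hq'
  have hpos : (0 : ℝ) ≤ (1 / (P.r (L + d) : ℝ)) ^ n := by positivity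
  by_cases e1 : q'.1 = q.1
  · by_cases e2 : q'.2 = q.2
    · have e : q' = q := Prod.ext e1 e2
      subst e
      simp only [sub_self, corr_zero, one_pow, if_true]
      linarith
    · have e : q' ≠ q := fun h => e2 (by rw [h])
      have hc : P.pairShift L ⟨d, q'⟩ - P.pairShift L ⟨d, q⟩ =
          P.colStart (L + d) q.2 - P.colStart (L + d) q'.2 := by
        simp only [pairShift, e1]
        ring
      rw [hc, corr_colStart_sub hL (by omega) (by omega) (Ne.symm e2)]
      simp [e, e1, e2]
  · have e : q' ≠ q := fun h => e1 (by rw [h])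
    by_cases e2 : q'.2 = q.2
    · have hc : P.pairShift L ⟨d, q'⟩ - P.pairShift L ⟨d, q⟩ =
          P.colStart (L + d) q'.1 - P.colStart (L + d) q.1 := by
        simp only [pairShift, e2]
        ring
      rw [hc, corr_colStart_sub hL (by omega) (by omega) e1]
      simp [e, e1, e2]
    -- In each pair the first column comes after the second, so both shifts lie in $[0,h_{j+1})$ and
    -- their difference is still decided at the next stage.
    · have hlt : |P.pairShift L ⟨d, q'⟩ - P.pairShift L ⟨d, q⟩| < P.height (L + (d + 1)) := by
        have a1 := P.colStart_add_lt h1 (P.height_pos (L + d))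
        have a2 := P.colStart_add_lt h1' (P.height_pos (L + d))
        have b1 := P.colStart_mono (L + d) (show q.2 ≤ q.1 by omega)
        have b2 := P.colStart_mono (L + d) (show q'.2 ≤ q'.1 by omega)
        simp only [pairShift]
        rw [← add_assoc, abs_lt]
        constructor <;> omega
      have hz : P.stageCorr L (d + 1) (P.pairShift L ⟨d, q'⟩ - P.pairShift L ⟨d, q⟩) = 0 :=
        stageCorr_succ_eq_zero fun a b ha hb =>
          (hL (L + d) (by omega)).height_le_of_ne (i := q'.1) (i' := q'.2) (l := q.1) (l' := q.2)
            h1' (by omega) h1 (by omega) ha hb e1 e2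
            (by omega) (by omega) (by omega)
      rw [corr_eq hL hlt, hz, zero_pow hn]
      simp [e, e1, e2]

/-- The pair `q` itself gives $1$. The terms for a common end number $2\lfloor r/2\rfloor\le r$ and
are $r^{-n}\le r^{-1}$ each, which gives at most another $1$. -/
lemma sum_corr_pairShift_sub_pow_le (hL : ∀ j, L ≤ j → P.IsLacunary j) {d : ℕ} {q : ℕ × ℕ}
    (hq : q ∈ P.halfPairs (L + d)) {n : ℕ} (hn : n ≠ 0) :
    ∑ q' ∈ P.halfPairs (L + d),
      P.corr L (P.pairShift L ⟨d, q'⟩ - P.pairShift L ⟨d, q⟩) ^ n ≤ 2 := by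
  have hr := P.two_le_r (L + d)
  set p := P.r (L + d) / 2 with hp
  refine (Finset.sum_le_sum fun q' hq' => corr_pairShift_sub_pow_le hL hq hq' hn).trans ?_
  rw [Finset.sum_add_distrib, ← Finset.sum_mul, Finset.sum_add_distrib, Finset.sum_ite_eq',
    if_pos hq]
  have hq0 := hq
  simp only [halfPairs, Finset.mem_product] at hq0
  have s1 : ∑ q' ∈ P.halfPairs (L + d), (if q'.1 = q.1 then (1 : ℝ) else 0) = p := by
    rw [halfPairs, Finset.sum_product_right]
    simp only [Finset.sum_ite_eq', if_pos hq0.1, Finset.sum_const, Finset.card_range,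
      nsmul_eq_mul, mul_one, hp]
  have s2 : ∑ q' ∈ P.halfPairs (L + d), (if q'.2 = q.2 then (1 : ℝ) else 0) = p := by
    rw [halfPairs, Finset.sum_product]
    simp only [Finset.sum_ite_eq', if_pos hq0.2, Finset.sum_const, Nat.card_Ico, nsmul_eq_mul,
      mul_one]
    congr 1
    omega
  rw [s1, s2]
  have hr0 : (0 : ℝ) < P.r (L + d) := by positivity
  have hr1 : (1 : ℝ) ≤ P.r (L + d) := by exact_mod_cast (by omega : 1 ≤ P.r (L + d))
  have h2p : (p : ℝ) + p ≤ P.r (L + d) := by exact_mod_cast (by omega : p + p ≤ P.r (L + d))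
  have hle : (P.r (L + d) : ℝ) ≤ (P.r (L + d) : ℝ) ^ n := le_self_pow₀ hr1 hn
  have : ((p : ℝ) + p) * (1 / (P.r (L + d) : ℝ)) ^ n ≤ 1 := by
    rw [div_pow, one_pow, mul_one_div, div_le_one (by positivity)]
    linarith
  linarith

/-- Within a stage the separation of differences applies. Across stages, equal shifts would give
$1=1/(rr')\le1/4$. -/
lemma injOn_pairShift (hL : ∀ j, L ≤ j → P.IsLacunary j) (M : ℕ) :
    Set.InjOn (P.pairShift L) ((Finset.range M).sigma fun d => P.halfPairs (L + d)) := by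
  rintro ⟨d, q⟩ hx ⟨d', q'⟩ hy hxy
  simp only [Finset.coe_sigma, Set.mem_sigma_iff, Finset.mem_coe] at hx hy
  by_cases hd : d = d'
  · subst hd
    obtain ⟨h1, h2, h3⟩ := mem_halfPairs hx.2
    obtain ⟨h1', h2', h3'⟩ := mem_halfPairs hy.2
    have := (hL (L + d) (by omega)).eq_of_abs_sub_lt h1 (show q.2 < P.r (L + d) by omega) h1'
      (show q'.2 < P.r (L + d) by omega) (by omega) (by
        have hpos := P.height_pos (L + d)
        simp only [pairShift] at hxy
        rw [hxy, sub_self, abs_zero]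
        omega)
    rw [Prod.ext this.1 this.2]
  · have e := corr_pairShift_sub_of_ne hL (x := ⟨d, q⟩) (y := ⟨d', q'⟩) hx.2 hy.2 hd
    rw [hxy, sub_self, corr_zero] at e
    have hb : ∀ j, 1 / (P.r j : ℝ) ≤ 1 / 2 := fun j =>
      one_div_le_one_div_of_le (by norm_num) (by exact_mod_cast P.two_le_r j)
    have hb0 : ∀ j, 0 ≤ 1 / (P.r j : ℝ) := fun j => by positivity
    nlinarith [hb (L + d), hb (L + d'), hb0 (L + d), hb0 (L + d')]

/-- If the numbers of columns do not grow too fast, then the powers of the correlations are the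
Fourier coefficients of a singular measure: the criterion of singularity by trigonometric
polynomials holds. -/
lemma exists_trigPoly (hL : ∀ j, L ≤ j → P.IsLacunary j) {n : ℕ} (hn : n ≠ 0)
    (hdiv : ¬ Summable fun j => (P.r j : ℝ) ^ 2 / (P.r j : ℝ) ^ (2 * n)) {κ : ℝ} (hκ : 0 ≤ κ)
    {ε : ℝ} (hε : 0 < ε) :
    ∃ (s : Finset ((_ : ℕ) × (ℕ × ℕ))) (a : (_ : ℕ) × (ℕ × ℕ) → ℝ)
      (m : (_ : ℕ) × (ℕ × ℕ) → ℤ),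
      κ * P.corr L 0 ^ n - 2 * ∑ x ∈ s, a x * (κ * P.corr L (m x) ^ n) +
        ∑ x ∈ s, ∑ y ∈ s, a x * a y * (κ * P.corr L (m y - m x) ^ n) ≤ ε ∧
      Set.InjOn m s ∧ ∑ x ∈ s, a x ^ 2 ≤ ε := by
  -- The share of stage `L + d` in $S$: the number of pairs times the squared weight $r^{-2n}$.
  set b : ℕ → ℝ := fun d => ((P.r (L + d) / 2 : ℕ) : ℝ) ^ 2 * (1 / (P.r (L + d) : ℝ)) ^ (2 * n)
    with hb
  have hb0 : ∀ d, 0 ≤ b d := fun d => by positivity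
  have hbdiv : ¬ Summable b := by
    intro hs
    refine hdiv ((summable_nat_add_iff L).1 ?_)
    -- The factor $9$ comes from $r\le3\lfloor r/2\rfloor$ for $r\ge2$.
    refine Summable.of_nonneg_of_le (fun d => by positivity) (fun d => ?_) (hs.mul_left 9)
    have h3 : (P.r (L + d) : ℝ) ≤ 3 * ((P.r (L + d) / 2 : ℕ) : ℝ) := by
      have := P.two_le_r (L + d)
      exact_mod_cast (by omega : P.r (L + d) ≤ 3 * (P.r (L + d) / 2))
    rw [add_comm d L, hb]
    simp only
    rw [div_eq_mul_one_div, ← one_div_pow, ← mul_assoc]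
    gcongr
    calc (P.r (L + d) : ℝ) ^ 2 ≤ (3 * ((P.r (L + d) / 2 : ℕ) : ℝ)) ^ 2 := by gcongr
      _ = _ := by ring
  have htend := (not_summable_iff_tendsto_nat_atTop_of_nonneg hb0).1 hbdiv
  obtain ⟨M, hM⟩ := (htend.eventually_ge_atTop (1 + 2 * κ / ε + 1 / ε)).exists
  set S := ∑ d ∈ Finset.range M, b d with hS
  have hS1 : 0 < S := lt_of_lt_of_le (by positivity) hM
  have hS2 : 2 * κ / S ≤ ε := by
    rw [div_le_iff₀ hS1]
    have : 2 * κ / ε ≤ S := by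
      have : 0 ≤ 1 / ε := by positivity
      linarith
    rw [div_le_iff₀ hε] at this
    linarith
  have hS3 : 1 / S ≤ ε := by
    rw [div_le_iff₀ hS1]
    have : 1 / ε ≤ S := by
      have : 0 ≤ 2 * κ / ε := by positivity
      linarith
    rw [div_le_iff₀ hε] at this
    linarith
  set ρ : ℕ → ℝ := fun d => (1 / (P.r (L + d) : ℝ)) ^ n with hρ
  have hρ0 : ∀ d, 0 ≤ ρ d := fun d => by positivity
  have hbρ : ∀ d, b d = ((P.halfPairs (L + d)).card : ℝ) * (ρ d * ρ d) := fun d => by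
    rw [card_halfPairs, hb, hρ]
    push_cast
    ring
  set s := (Finset.range M).sigma fun d => P.halfPairs (L + d) with hs
  -- Weights proportional to the correlations with $1$, normalized by `hsum1`; then the constant,
  -- linear and main quadratic terms cancel as $\kappa-2\kappa+\kappa$.
  set a : (_ : ℕ) × (ℕ × ℕ) → ℝ := fun x => ρ x.1 / S with ha
  have ha0 : ∀ x, 0 ≤ a x := fun x => div_nonneg (hρ0 _) hS1.le
  have hmem : ∀ x ∈ s, x.2 ∈ P.halfPairs (L + x.1) := fun x hx => (Finset.mem_sigma.1 hx).2
  have hsum1 : ∑ x ∈ s, a x * ρ x.1 = 1 := by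
    rw [hs, Finset.sum_sigma]
    simp only [ha, Finset.sum_const, nsmul_eq_mul]
    rw [← div_self hS1.ne', hS, Finset.sum_div]
    refine Finset.sum_congr rfl fun d _ => ?_
    rw [hbρ]
    ring
  have hsum2 : ∑ x ∈ s, a x ^ 2 = 1 / S := by
    have : ∀ x, a x ^ 2 = a x * ρ x.1 * (1 / S) := fun x => by
      simp only [ha]
      ring
    simp only [this]
    rw [← Finset.sum_mul, hsum1, one_mul]
  have hlin : ∑ x ∈ s, a x * (κ * P.corr L (P.pairShift L x) ^ n) = κ := by
    have : ∀ x ∈ s, a x * (κ * P.corr L (P.pairShift L x) ^ n) = κ * (a x * ρ x.1) :=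
      fun x hx => by
        rw [corr_pairShift hL (hmem x hx)]
        ring
    rw [Finset.sum_congr rfl this, ← Finset.mul_sum, hsum1, mul_one]
  -- The product $\rho\rho'$ is exact across stages; within a stage the true correlation is added as
  -- an error, which `hdiag` sums.
  have hpt : ∀ x ∈ s, ∀ y ∈ s, P.corr L (P.pairShift L y - P.pairShift L x) ^ n ≤
      ρ x.1 * ρ y.1 +
        if y.1 = x.1 then P.corr L (P.pairShift L y - P.pairShift L x) ^ n else 0 := by
    intro x hx y hy
    by_cases hxy : y.1 = x.1
    · rw [if_pos hxy]
      have := mul_nonneg (hρ0 x.1) (hρ0 y.1)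
      linarith
    · rw [if_neg hxy, add_zero, corr_pairShift_sub_of_ne hL (hmem x hx) (hmem y hy) (Ne.symm hxy),
        mul_pow]
  have hdiag : ∀ x ∈ s, ∑ y ∈ s, a x * a y *
      (if y.1 = x.1 then P.corr L (P.pairShift L y - P.pairShift L x) ^ n else 0) ≤
        2 * a x ^ 2 := by
    rintro ⟨d, q⟩ hx
    obtain ⟨hd, hq⟩ := Finset.mem_sigma.1 hx
    rw [hs, Finset.sum_sigma, Finset.sum_eq_single d]
    · simp only [if_true, ha]
      rw [← Finset.mul_sum]
      have := sum_corr_pairShift_sub_pow_le hL hq hn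
      have h0 : 0 ≤ ρ d / S * (ρ d / S) := mul_self_nonneg _
      calc _ ≤ ρ d / S * (ρ d / S) * 2 := mul_le_mul_of_nonneg_left this h0
        _ = _ := by ring
    · intro d' _ hne
      refine Finset.sum_eq_zero fun q' _ => ?_
      simp [hne]
    · exact fun h => absurd hd h
  have hquad : ∑ x ∈ s, ∑ y ∈ s, a x * a y *
      (κ * P.corr L (P.pairShift L y - P.pairShift L x) ^ n) ≤ κ * (1 + 2 * (1 / S)) := by
    calc ∑ x ∈ s, ∑ y ∈ s, a x * a y * (κ * P.corr L (P.pairShift L y - P.pairShift L x) ^ n)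
        = κ * ∑ x ∈ s, ∑ y ∈ s, a x * a y *
            P.corr L (P.pairShift L y - P.pairShift L x) ^ n := by
          simp only [Finset.mul_sum]
          refine Finset.sum_congr rfl fun x _ => Finset.sum_congr rfl fun y _ => ?_
          ring
      _ ≤ κ * (∑ x ∈ s, (∑ y ∈ s, (a x * ρ x.1) * (a y * ρ y.1) + 2 * a x ^ 2)) := by
          refine mul_le_mul_of_nonneg_left (Finset.sum_le_sum fun x hx => ?_) hκ
          refine le_trans (Finset.sum_le_sum fun y hy => mul_le_mul_of_nonneg_left
            (hpt x hx y hy) (mul_nonneg (ha0 x) (ha0 y))) ?_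
          simp only [mul_add, Finset.sum_add_distrib]
          refine add_le_add (le_of_eq (Finset.sum_congr rfl fun y _ => by ring)) (hdiag x hx)
      _ = κ * (1 + 2 * (1 / S)) := by
          rw [Finset.sum_add_distrib, ← Finset.sum_mul_sum, hsum1, ← Finset.mul_sum, hsum2]
          ring
  refine ⟨s, a, P.pairShift L, ?_, injOn_pairShift hL M, hsum2.trans_le hS3⟩
  rw [corr_zero, one_pow, hlin]
  have e : κ * (1 + 2 * (1 / S)) = κ + 2 * κ / S := by ring
  linarith

end RankOneParams

/-! ### Copies of the base inside later towers. -/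

namespace RankOneParams

variable (P : RankOneParams)

/-- The numbers of the floors of stage `L + d` that make up the base of stage `L`. -/
def copies (L : ℕ) : ℕ → Finset ℕ
  | 0 => {0}
  | d + 1 => (Finset.range (P.r (L + d)) ×ˢ copies L d).image fun q => P.colStart (L + d) q.1 + q.2

variable {P} {L : ℕ}

lemma mem_copies_succ {d a : ℕ} : a ∈ P.copies L (d + 1) ↔
    ∃ i, i < P.r (L + d) ∧ ∃ b ∈ P.copies L d, a = P.colStart (L + d) i + b := by
  simp only [copies, Finset.mem_image, Finset.mem_product, Finset.mem_range, Prod.exists]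
  constructor
  · rintro ⟨i, b, ⟨hi, hb⟩, rfl⟩
    exact ⟨i, hi, b, hb, rfl⟩
  · rintro ⟨i, hi, b, hb, rfl⟩
    exact ⟨i, b, ⟨hi, hb⟩, rfl⟩

lemma add_lt_of_mem_copies {d a k : ℕ} (ha : a ∈ P.copies L d) (hk : k < P.height L) :
    a + k < P.height (L + d) := by
  induction d generalizing a with
  | zero =>
    simp only [copies, Finset.mem_singleton] at ha
    subst ha
    simpa using hk
  | succ d ih =>
    obtain ⟨i, hi, b, hb, rfl⟩ := mem_copies_succ.1 ha
    have := P.colStart_add_lt hi (ih hb)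
    rw [← add_assoc]
    omega

/-- Copies in different columns have different floor numbers, so the image defining `copies` has no
repetitions. -/
lemma sum_copies_succ {d : ℕ} (g : ℕ → ℝ) : ∑ a ∈ P.copies L (d + 1), g a =
    ∑ i ∈ Finset.range (P.r (L + d)), ∑ a ∈ P.copies L d, g (P.colStart (L + d) i + a) := by
  rw [copies, Finset.sum_image, Finset.sum_product]
  rintro ⟨i, a⟩ hq ⟨i', a'⟩ hq' heq
  simp only [Finset.coe_product, Set.mem_prod, Finset.mem_coe, Finset.mem_range] at hq hq'
  have ha := add_lt_of_mem_copies hq.2 (P.height_pos L)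
  have ha' := add_lt_of_mem_copies hq'.2 (P.height_pos L)
  have hlt : ∀ {i i' a a' : ℕ}, a < P.height (L + d) →
      P.colStart (L + d) i + a = P.colStart (L + d) i' + a' → ¬ i < i' := by
    intro i i' a a' ha heq hii
    have := P.colStart_mono (L + d) (Nat.succ_le_of_lt hii)
    rw [Nat.succ_eq_add_one, colStart_succ] at this
    omega
  simp only at heq
  have h1 := hlt (by omega) heq
  have h2 := hlt (by omega) heq.symm
  obtain rfl : i = i' := by omega
  simp at heq
  rw [heq]

variable (P) in
/-- The number of pairs of copies of the base at the given distance. -/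
noncomputable def pairCount (L d : ℕ) (m : ℤ) : ℝ :=
  ∑ a ∈ P.copies L d, ∑ b ∈ P.copies L d, if (b : ℤ) - a = m then 1 else 0

lemma pairCount_succ (d : ℕ) (m : ℤ) : P.pairCount L (d + 1) m =
    ∑ i ∈ Finset.range (P.r (L + d)), ∑ i' ∈ Finset.range (P.r (L + d)),
      P.pairCount L d (m - (P.colStart (L + d) i - P.colStart (L + d) i')) := by
  simp only [pairCount]
  simp_rw [sum_copies_succ (P := P)]
  rw [Finset.sum_comm (s := Finset.range (P.r (L + d))) (t := Finset.range (P.r (L + d)))]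
  refine Finset.sum_congr rfl fun i' _ => ?_
  rw [Finset.sum_comm]
  refine Finset.sum_congr rfl fun i _ => Finset.sum_congr rfl fun a _ =>
    Finset.sum_congr rfl fun b _ => ?_
  congr 1
  push_cast
  rw [eq_iff_iff]
  constructor <;> intro h <;> linarith

end RankOneParams

/-! ### Correlations of floors and of their products. -/

namespace RankOneConstruction

variable (C : RankOneConstruction)

/-- Both sides obey the same recursion, because the width is divided by $r$ at each stage. -/
lemma width_mul_pairCount (L d : ℕ) (m : ℤ) :
    C.width (L + d) * C.pairCount L d m = C.width L * C.stageCorr L d m := by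
  induction d generalizing m with
  | zero =>
    simp only [RankOneParams.pairCount, RankOneParams.copies, RankOneParams.stageCorr,
      Finset.sum_singleton, add_zero, Nat.cast_zero, sub_self]
    simp only [eq_comm]
  | succ d ih =>
    have hr := C.r_pos (L + d)
    have hw : C.width (L + (d + 1)) = C.width (L + d) / C.r (L + d) := by
      rw [C.width_eq (L + d), ← add_assoc]
      field_simp
    rw [RankOneParams.pairCount_succ, RankOneParams.stageCorr, hw, mul_div_assoc', div_mul_eq_mul_div]
    congr 1
    simp only [Finset.mul_sum]
    exact Finset.sum_congr rfl fun i _ => Finset.sum_congr rfl fun i' _ => ih _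

lemma subfloor_subset {j k i : ℕ} (hk : k < C.height j) (hi : i < C.r j) :
    C.floor (j + 1) (C.colStart j i + k) ⊆ C.floor j k := by
  intro x hx
  have hw := C.width_pos (j + 1)
  simp only [floor, mem_Ico, C.left_colStart hk hi] at hx ⊢
  rw [C.width_eq j]
  have h1 : (0 : ℝ) ≤ i * C.width (j + 1) := by positivity
  have h2 : ((i : ℝ) + 1) * C.width (j + 1) ≤ C.r j * C.width (j + 1) := by
    gcongr
    exact_mod_cast hi
  constructor <;> linarith [hx.1, hx.2]

lemma mem_floor_iff {L k : ℕ} (hk : k < C.height L) (d : ℕ) {x : ℝ} :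
    x ∈ C.floor L k ↔ ∃ a ∈ C.copies L d, x ∈ C.floor (L + d) (a + k) := by
  induction d with
  | zero => simp [RankOneParams.copies]
  | succ d ih =>
    rw [ih]
    constructor
    · rintro ⟨a, ha, hx⟩
      obtain ⟨i, hi, hxi⟩ := C.exists_subfloor (RankOneParams.add_lt_of_mem_copies ha hk) hx
      refine ⟨_, RankOneParams.mem_copies_succ.2 ⟨i, hi, a, ha, rfl⟩, ?_⟩
      rw [add_assoc (C.colStart _ _)]
      exact hxi
    · rintro ⟨a, ha, hx⟩
      obtain ⟨i, hi, b, hb, rfl⟩ := RankOneParams.mem_copies_succ.1 ha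
      rw [add_assoc (C.colStart _ _)] at hx
      exact ⟨b, hb, C.subfloor_subset (RankOneParams.add_lt_of_mem_copies hb hk) hi hx⟩

lemma floor_subset_space {j k : ℕ} (hk : k < C.height j) : C.floor j k ⊆ C.space := fun _ hx =>
  mem_iUnion.2 ⟨j, C.mem_tower.2 ⟨k, hk, hx⟩⟩

lemma real_μ_floor {j k : ℕ} (hk : k < C.height j) : C.μ.real (C.floor j k) = C.width j := by
  rw [μ, measureReal_restrict_apply (C.measurableSet_floor j k),
    inter_eq_left.2 (C.floor_subset_space hk), floor, Real.volume_real_Ico_of_le]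
  · ring
  · linarith [C.width_pos j]

lemma μ_floor_ne_top (j k : ℕ) : C.μ (C.floor j k) ≠ ⊤ := by
  refine ne_top_of_le_ne_top ?_ (Measure.restrict_apply_le _ _)
  simp [floor]

lemma iterate_T_mem_floor {j k m : ℕ} {x : ℝ} (hk : k + m < C.height j) (hx : x ∈ C.floor j k) :
    C.T^[m] x ∈ C.floor j (k + m) := by
  induction m with
  | zero => exact hx
  | succ m ih =>
    have h := ih (by omega)
    rw [Function.iterate_succ_apply', C.T_eq (by omega) h]
    simp only [floor, mem_Ico] at h ⊢
    rw [← add_assoc]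
    constructor <;> linarith [h.1, h.2]

/-- By `hd` there is room for `m` steps above every copy, so $T^m$ climbs `m` floors; the point
returns exactly when the floor reached belongs to another copy. -/
lemma floor_inter_preimage {L k m d : ℕ} (hk : k < C.height L)
    (hd : ∀ a ∈ C.copies L d, a + k + m < C.height (L + d)) :
    C.floor L k ∩ C.T^[m] ⁻¹' C.floor L k =
      ⋃ a ∈ (C.copies L d).filter (fun a => a + m ∈ C.copies L d), C.floor (L + d) (a + k) := by
  ext x
  simp only [mem_inter_iff, mem_preimage, mem_iUnion, Finset.mem_filter, exists_prop]
  constructor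
  · rintro ⟨hx, hTx⟩
    obtain ⟨a, ha, hxa⟩ := (C.mem_floor_iff hk d).1 hx
    obtain ⟨b, hb, hxb⟩ := (C.mem_floor_iff hk d).1 hTx
    have e := C.floor_inj (hd a ha) (RankOneParams.add_lt_of_mem_copies hb hk)
      (C.iterate_T_mem_floor (hd a ha) hxa) hxb
    exact ⟨a, ⟨ha, by rwa [show a + m = b by omega]⟩, hxa⟩
  · rintro ⟨a, ⟨ha, hb⟩, hxa⟩
    refine ⟨(C.mem_floor_iff hk d).2 ⟨a, ha, hxa⟩, (C.mem_floor_iff hk d).2 ⟨a + m, hb, ?_⟩⟩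
    have := C.iterate_T_mem_floor (hd a ha) hxa
    rwa [show a + m + k = a + k + m by omega]

lemma real_μ_floor_inter_preimage {L k m d : ℕ} (hk : k < C.height L)
    (hd : ∀ a ∈ C.copies L d, a + k + m < C.height (L + d)) :
    C.μ.real (C.floor L k ∩ C.T^[m] ⁻¹' C.floor L k) = C.width L * C.stageCorr L d m := by
  have hlt : ∀ a ∈ C.copies L d, a + k < C.height (L + d) := fun a ha =>
    RankOneParams.add_lt_of_mem_copies ha hk
  rw [C.floor_inter_preimage hk hd, measureReal_biUnion_finset ?_ ?_
    fun a _ => C.μ_floor_ne_top _ _]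
  · rw [Finset.sum_congr rfl fun a ha => C.real_μ_floor (hlt a (Finset.mem_filter.1 ha).1),
      Finset.sum_const, nsmul_eq_mul, mul_comm, ← C.width_mul_pairCount]
    congr 1
    rw [RankOneParams.pairCount, Finset.card_filter]
    push_cast
    refine Finset.sum_congr rfl fun a _ => ?_
    have : ∀ b : ℕ, ((b : ℤ) - a = m) ↔ b = a + m := fun b => by omega
    simp only [this, Finset.sum_ite_eq']
  · intro a ha b hb hne
    exact C.disjoint_floor (L + d) _ _ (hlt a (Finset.mem_filter.1 ha).1)
      (hlt b (Finset.mem_filter.1 hb).1) (by omega)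
  · exact fun a _ => C.measurableSet_floor _ _

/-- The correlations of a floor. -/
lemma real_μ_floor_inter_preimage_eq_corr {L k : ℕ} (hL : ∀ j, L ≤ j → C.IsLacunary j)
    (hk : k < C.height L) (m : ℕ) :
    C.μ.real (C.floor L k ∩ C.T^[m] ⁻¹' C.floor L k) = C.width L * C.corr L m := by
  -- The last column of stage `L + m` carries at least $h_{L+m}>m$ spacers, so at the next stage no
  -- copy is within `m` floors of the top.
  rw [C.real_μ_floor_inter_preimage hk (d := m + 1), RankOneParams.corr_eq hL]
  · have := C.lt_height (L + (m + 1))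
    rw [Nat.abs_cast]
    omega
  · intro a ha
    obtain ⟨i, hi, b, hb, rfl⟩ := RankOneParams.mem_copies_succ.1 ha
    have h1 := RankOneParams.add_lt_of_mem_copies hb hk
    have h2 := (hL (L + m) (by omega)).height_le_last
    have h3 := C.lt_height (L + m)
    have h4 := C.colStart_mono (L + m) (show i ≤ C.r (L + m) - 1 by omega)
    have h5 := C.colStart_succ (L + m) (C.r (L + m) - 1)
    rw [show C.r (L + m) - 1 + 1 = C.r (L + m) by omega, ← C.height_succ] at h5
    rw [← add_assoc L m 1]
    omega

/-- A product of floors of stage `L`. -/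
def box {n : ℕ} (L : ℕ) (k : Fin n → ℕ) : Set (Fin n → ℝ) := Set.pi univ fun i => C.floor L (k i)

lemma measurableSet_box {n : ℕ} (L : ℕ) (k : Fin n → ℕ) : MeasurableSet (C.box L k) :=
  MeasurableSet.univ_pi fun _ => C.measurableSet_floor _ _

lemma μpow_box_ne_top {n : ℕ} (L : ℕ) (k : Fin n → ℕ) : C.μpow n (C.box L k) ≠ ⊤ := by
  rw [box, Measure.pi_pi]
  exact ENNReal.prod_ne_top fun i _ => C.μ_floor_ne_top _ _

/-- The indicator of a product of floors. -/
noncomputable def boxVec {n : ℕ} (L : ℕ) (k : Fin n → ℕ) : Lp ℂ 2 (C.μpow n) :=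
  indicatorConstLp 2 (C.measurableSet_box L k) (C.μpow_box_ne_top L k) 1

lemma tensorPower_pow_boxVec {n : ℕ} (L : ℕ) (k : Fin n → ℕ) (m : ℕ) :
    (C.tensorPower n ^ m) (C.boxVec L k) =
      indicatorConstLp 2
        ((C.measurableSet_box L k).preimage ((C.measurePreserving_Tpow n).iterate m).measurable)
        (by
          rw [((C.measurePreserving_Tpow n).iterate m).measure_preimage
            (C.measurableSet_box L k).nullMeasurableSet]
          exact C.μpow_box_ne_top L k) 1 := by
  induction m with
  | zero => rfl
  | succ m ih =>
    rw [pow_succ']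
    change C.tensorPower n ((C.tensorPower n ^ m) (C.boxVec L k)) = _
    rw [ih]
    rfl

lemma Tpow_iterate {n : ℕ} (m : ℕ) (x : Fin n → ℝ) (i : Fin n) :
    (C.Tpow n)^[m] x i = C.T^[m] (x i) := by
  induction m generalizing x with
  | zero => rfl
  | succ m ih =>
    rw [Function.iterate_succ_apply, Function.iterate_succ_apply, ih]
    rfl

/-- The correlations of the indicator of a product of floors. -/
lemma inner_boxVec {n L : ℕ} (hL : ∀ j, L ≤ j → C.IsLacunary j) {k : Fin n → ℕ}
    (hk : ∀ i, k i < C.height L) (m : ℤ) :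
    inner ℂ (C.boxVec L k) ((C.tensorPower n ^ m) (C.boxVec L k)) =
      ((C.width L ^ n * C.corr L m ^ n : ℝ) : ℂ) := by
  have hnat : ∀ m : ℕ, inner ℂ (C.boxVec L k) ((C.tensorPower n ^ m) (C.boxVec L k)) =
      ((C.width L ^ n * C.corr L m ^ n : ℝ) : ℂ) := by
    intro m
    have hset : C.box L k ∩ (C.Tpow n)^[m] ⁻¹' C.box L k =
        Set.pi univ fun i => C.floor L (k i) ∩ C.T^[m] ⁻¹' C.floor L (k i) := by
      ext x
      simp only [box, mem_inter_iff, mem_preimage, mem_univ_pi, Tpow_iterate]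
      exact forall_and.symm
    have hreal : (C.μpow n).real (C.box L k ∩ (C.Tpow n)^[m] ⁻¹' C.box L k) =
        C.width L ^ n * C.corr L m ^ n := by
      rw [hset, Measure.real, Measure.pi_pi, ENNReal.toReal_prod, ← mul_pow]
      refine (Finset.prod_congr rfl fun i _ =>
        C.real_μ_floor_inter_preimage_eq_corr hL (hk i) m).trans ?_
      simp
    rw [tensorPower_pow_boxVec, boxVec, L2.inner_indicatorConstLp_one_indicatorConstLp_one _ _
      (C.μpow_box_ne_top L k) (by
        rw [((C.measurePreserving_Tpow n).iterate m).measure_preimage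
          (C.measurableSet_box L k).nullMeasurableSet]
        exact C.μpow_box_ne_top L k), hreal]
    rfl
  obtain ⟨m', rfl | rfl⟩ := m.eq_nat_or_neg
  · rw [zpow_natCast]
    exact hnat m'
  -- Unitarity turns the coefficient at $-m'$ into the conjugate of the one at $m'$, which is real.
  · rw [RankOneParams.corr_neg, ← hnat m', ← inner_conj_symm,
      ← (C.tensorPower n ^ m').inner_map_map, zpow_neg, zpow_natCast]
    change starRingEnd ℂ (inner ℂ ((C.tensorPower n ^ m' * (C.tensorPower n ^ m')⁻¹) _) _) = _
    rw [mul_inv_cancel]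
    change starRingEnd ℂ (inner ℂ (C.boxVec L k) _) = _
    rw [hnat, Complex.conj_ofReal]

end RankOneConstruction

/-! ### Totality of the indicators of products of floors. -/

namespace RankOneConstruction

variable (C : RankOneConstruction)

/-- The `n`-th power of the tower of stage `j`. -/
def towerPow (n j : ℕ) : Set (Fin n → ℝ) := Set.pi univ fun _ => C.tower j

lemma measurableSet_towerPow (n j : ℕ) : MeasurableSet (C.towerPow n j) :=
  MeasurableSet.univ_pi fun _ => C.measurableSet_tower j

lemma μ_tower_ne_top (j : ℕ) : C.μ (C.tower j) ≠ ⊤ := by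
  rw [tower]
  refine ne_top_of_le_ne_top ?_ (measure_biUnion_finset_le _ _)
  exact ENNReal.sum_ne_top.2 fun k _ => C.μ_floor_ne_top j k

lemma μpow_towerPow_ne_top (n j : ℕ) : C.μpow n (C.towerPow n j) ≠ ⊤ := by
  rw [towerPow, Measure.pi_pi]
  exact ENNReal.prod_ne_top fun i _ => C.μ_tower_ne_top j

/-- A later floor that meets $X_J$ is one of the pieces into which the floors of $X_J$ are cut. -/
lemma floor_subset_tower {J d k : ℕ} {x : ℝ} (hk : k < C.height (J + d)) (hx : x ∈ C.tower J)
    (hxk : x ∈ C.floor (J + d) k) : C.floor (J + d) k ⊆ C.tower J := by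
  intro y hy
  obtain ⟨k', hk', hx'⟩ := C.mem_tower.1 hx
  obtain ⟨a, ha, hxa⟩ := (C.mem_floor_iff hk' d).1 hx'
  have e := C.floor_inj hk (RankOneParams.add_lt_of_mem_copies ha hk') hxk hxa
  exact C.mem_tower.2 ⟨k', hk', (C.mem_floor_iff hk' d).2 ⟨a, ha, e ▸ hy⟩⟩

lemma disjoint_box {n j : ℕ} {k k' : Fin n → ℕ} (hk : ∀ i, k i < C.height j)
    (hk' : ∀ i, k' i < C.height j) (hne : k ≠ k') : Disjoint (C.box j k) (C.box j k') := by
  refine Set.disjoint_left.2 fun x hx hx' => hne (funext fun i => ?_)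
  exact C.floor_inj (hk i) (hk' i) (hx i (mem_univ i)) (hx' i (mem_univ i))

open Classical in
/-- The products of floors of stage `j` contained in a given set. -/
noncomputable def innerBoxes {n : ℕ} (A : Set (Fin n → ℝ)) (j : ℕ) : Finset (Fin n → ℕ) :=
  (Fintype.piFinset fun _ => Finset.range (C.height j)).filter fun k => C.box j k ⊆ A

lemma mem_innerBoxes {n : ℕ} {A : Set (Fin n → ℝ)} {j : ℕ} {k : Fin n → ℕ} :
    k ∈ C.innerBoxes A j ↔ (∀ i, k i < C.height j) ∧ C.box j k ⊆ A := by
  simp [innerBoxes]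

/-- The union of the products of floors of stage `j` contained in a given set. -/
def innerApprox {n : ℕ} (A : Set (Fin n → ℝ)) (j : ℕ) : Set (Fin n → ℝ) :=
  ⋃ k ∈ C.innerBoxes A j, C.box j k

lemma measurableSet_innerApprox {n : ℕ} (A : Set (Fin n → ℝ)) (j : ℕ) :
    MeasurableSet (C.innerApprox A j) :=
  Finset.measurableSet_biUnion _ fun _ _ => C.measurableSet_box _ _

lemma mem_innerApprox {n : ℕ} {A : Set (Fin n → ℝ)} {j : ℕ} {x : Fin n → ℝ} :
    x ∈ C.innerApprox A j ↔ ∃ k : Fin n → ℕ, ((∀ i, k i < C.height j) ∧ C.box j k ⊆ A) ∧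
      x ∈ C.box j k := by
  simp only [innerApprox, mem_iUnion, mem_innerBoxes, exists_prop]

lemma innerApprox_mono {n : ℕ} (A : Set (Fin n → ℝ)) : Monotone (C.innerApprox A) := by
  refine monotone_nat_of_le_succ fun j x hx => ?_
  obtain ⟨k, ⟨hk, hkA⟩, hx⟩ := C.mem_innerApprox.1 hx
  choose i hi hxi using fun l => C.exists_subfloor (hk l) (hx l (mem_univ l))
  refine C.mem_innerApprox.2 ⟨fun l => C.colStart j (i l) + k l,
    ⟨fun l => C.colStart_add_lt (hi l) (hk l), fun y hy => hkA fun l _ => ?_⟩, fun l _ => hxi l⟩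
  exact C.subfloor_subset (hk l) (hi l) (hy l (mem_univ l))

/-- The widths tend to $0$, so a late box around a point stays in `U`; it stays in the power of the
tower by `floor_subset_tower`. -/
lemma iUnion_innerApprox {n J : ℕ} {U : Set (Fin n → ℝ)} (hU : IsOpen U) :
    ⋃ d, C.innerApprox (U ∩ C.towerPow n J) (J + d) = U ∩ C.towerPow n J := by
  refine Subset.antisymm (iUnion_subset fun d x hx => ?_) fun x hx => ?_
  · obtain ⟨k, ⟨-, hkA⟩, hx⟩ := C.mem_innerApprox.1 hx
    exact hkA hx
  obtain ⟨ε, hε, hball⟩ := Metric.isOpen_iff.1 hU x hx.1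
  have hlim : Tendsto (fun d : ℕ => C.width₁ * (1 / 2 : ℝ) ^ d) atTop (𝓝 (C.width₁ * 0)) :=
    (tendsto_pow_atTop_nhds_zero_of_lt_one (by norm_num) (by norm_num)).const_mul _
  rw [mul_zero] at hlim
  obtain ⟨d, hd⟩ := (hlim.eventually_lt_const hε).exists
  have hw : C.width (J + d) < ε := by
    refine lt_of_le_of_lt ((C.width_le (J + d)).trans ?_) hd
    have := C.width₁_pos
    gcongr C.width₁ * ?_
    exact pow_le_pow_of_le_one (by norm_num) (by norm_num) (by omega)
  have hxd : ∀ l, ∃ k, k < C.height (J + d) ∧ x l ∈ C.floor (J + d) k := fun l =>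
    C.mem_tower.1 (C.tower_mono (by omega : J ≤ J + d) (hx.2 l (mem_univ l)))
  choose k hk hxk using hxd
  refine mem_iUnion.2 ⟨d, C.mem_innerApprox.2 ⟨k, ⟨hk, fun y hy => ⟨hball ?_, fun l _ => ?_⟩⟩,
    fun l _ => hxk l⟩⟩
  · rw [Metric.mem_ball, dist_pi_lt_iff hε]
    intro l
    have h1 := hy l (mem_univ l)
    have h2 := hxk l
    simp only [floor, mem_Ico] at h1 h2
    rw [Real.dist_eq, abs_lt]
    constructor <;> linarith [h1.1, h1.2, h2.1, h2.2]
  · exact C.floor_subset_tower (hk l) (hx.2 l (mem_univ l)) (hxk l) (hy l (mem_univ l))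

/-- A function with zero integrals over the products of floors is zero. -/
lemma ae_eq_zero_of_forall_box {n L : ℕ} (g : Lp ℂ 2 (C.μpow n))
    (h : ∀ j, L ≤ j → ∀ k : Fin n → ℕ, (∀ i, k i < C.height j) →
      ∫ x in C.box j k, g x ∂(C.μpow n) = 0) : g =ᵐ[C.μpow n] 0 := by
  have hint : ∀ A, C.μpow n A ≠ ⊤ → IntegrableOn g A (C.μpow n) := fun A hA =>
    integrableOn_Lp_of_measure_ne_top g (by norm_num) hA
  have hopen : ∀ J, L ≤ J → ∀ U : Set (Fin n → ℝ), IsOpen U →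
      ∫ x in U ∩ C.towerPow n J, g x ∂(C.μpow n) = 0 := by
    intro J hJ U hU
    have hzero : ∀ d, ∫ x in C.innerApprox (U ∩ C.towerPow n J) (J + d), g x ∂(C.μpow n) = 0 := by
      intro d
      rw [innerApprox, integral_biUnion_finset]
      · exact Finset.sum_eq_zero fun k hk => h _ (by omega) k (C.mem_innerBoxes.1 hk).1
      · exact fun k _ => C.measurableSet_box _ _
      · exact fun k hk k' hk' hne => C.disjoint_box (C.mem_innerBoxes.1 hk).1
          (C.mem_innerBoxes.1 hk').1 hne
      · exact fun k _ => hint _ (C.μpow_box_ne_top _ _)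
    have hlim := tendsto_setIntegral_of_monotone (μ := C.μpow n) (f := g)
      (s := fun d => C.innerApprox (U ∩ C.towerPow n J) (J + d))
      (fun d => C.measurableSet_innerApprox _ _)
      (fun d d' hd => C.innerApprox_mono _ (by omega))
      (by
        rw [C.iUnion_innerApprox hU]
        exact hint _ (ne_top_of_le_ne_top (C.μpow_towerPow_ne_top n J)
          (measure_mono inter_subset_right)))
    rw [C.iUnion_innerApprox hU] at hlim
    simp only [hzero] at hlim
    exact tendsto_nhds_unique hlim tendsto_const_nhds
  have htower : ∀ J, L ≤ J → ∀ᵐ x ∂(C.μpow n), x ∈ C.towerPow n J → g x = 0 := by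
    intro J hJ
    rw [← ae_restrict_iff' (C.measurableSet_towerPow n J)]
    have hg := hint _ (C.μpow_towerPow_ne_top n J)
    have ho : ∀ U : Set (Fin n → ℝ), IsOpen U →
        ∫ x in U, g x ∂(C.μpow n).restrict (C.towerPow n J) = 0 := fun U hU => by
      rw [Measure.restrict_restrict hU.measurableSet, hopen J hJ U hU]
    -- The integral over a closed set is the total integral minus that over an open set, and both
    -- vanish.
    refine ae_eq_zero_of_forall_setIntegral_isClosed_eq_zero hg fun s hs => ?_
    have h1 := integral_add_compl hs.measurableSet hg
    rw [ho _ hs.isOpen_compl, add_zero] at h1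
    rw [h1, ← setIntegral_univ, ho _ isOpen_univ]
  have hspace : ∀ᵐ x ∂(C.μpow n), ∀ i, x i ∈ C.space := by
    refine ae_all_iff.2 fun i => ?_
    exact (Measure.quasiMeasurePreserving_eval (μ := fun _ : Fin n => C.μ) i).ae
      (p := fun y => y ∈ C.space) (ae_restrict_mem C.measurableSet_space)
  have hall : ∀ᵐ x ∂(C.μpow n), ∀ J, L ≤ J → x ∈ C.towerPow n J → g x = 0 := by
    refine ae_all_iff.2 fun J => ?_
    by_cases hJ : L ≤ J
    · filter_upwards [htower J hJ] with x hx _ using hx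
    · exact ae_of_all _ fun x h => absurd h hJ
  filter_upwards [hspace, hall] with x hx hgx
  choose J hJ using fun i => mem_iUnion.1 (hx i)
  -- One stage, at least `L`, whose tower contains all coordinates.
  refine hgx (L + ∑ i, J i) (by omega) fun i _ => C.tower_mono ?_ (hJ i)
  have := Finset.single_le_sum (f := J) (fun _ _ => Nat.zero_le _) (Finset.mem_univ i)
  omega

/-- The indicators of the products of floors of stages from `L` on are total. -/
lemma topologicalClosure_span_boxVec (n L : ℕ) :
    (Submodule.span ℂ {f | ∃ j, L ≤ j ∧ ∃ k : Fin n → ℕ, (∀ i, k i < C.height j) ∧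
      f = C.boxVec j k}).topologicalClosure = ⊤ := by
  rw [Submodule.topologicalClosure_eq_top_iff, Submodule.eq_bot_iff]
  intro g hg
  refine (Lp.eq_zero_iff_ae_eq_zero).2 (C.ae_eq_zero_of_forall_box (L := L) g fun j hj k hk => ?_)
  rw [← L2.inner_indicatorConstLp_one (𝕜 := ℂ) (C.measurableSet_box j k) (C.μpow_box_ne_top j k) g]
  exact (Submodule.mem_orthogonal _ _).1 hg _
    (Submodule.subset_span ⟨j, hj, k, hk, rfl⟩)

end RankOneConstruction

/-! ### The dichotomy. -/

theorem theorem4 (C : RankOneConstruction) (ν : ℝ) (hν : 0 ≤ ν) (hC : C.IsSidonOfClass ν)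
    (n : ℕ) (hn : 1 ≤ n) :
    (2 * (n : ℝ) - 2 ≤ ν → HasSingularSpectrum (C.tensorPower n)) ∧
    (ν < 2 * (n : ℝ) - 2 → HasAbsolutelyContinuousSpectrum (C.tensorPower n)) := by
  obtain ⟨L, hL⟩ := C.exists_isLacunary hC.fastSpacers
  have hn0 : n ≠ 0 := by omega
  constructor
  · intro h
    refine hasSingularSpectrum_of_total (C.topologicalClosure_span_boxVec n L) ?_
    rintro f ⟨j, hj, k, hk, rfl⟩ σ ⟨hfin, hσ⟩
    -- The correlations are normalized from the stage `j` of the generator itself.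
    have hLj : ∀ i, j ≤ i → C.IsLacunary i := fun i hi => hL i (hj.trans hi)
    refine mutuallySingular_volume_of_trigPoly (ι := (_ : ℕ) × (ℕ × ℕ))
      (fun m => (hσ m).trans (C.inner_boxVec hLj hk m)) fun ε hε => ?_
    exact RankOneParams.exists_trigPoly hLj hn0
      (RankOneParams.not_summable_sq_div_pow hC.columnGrowth hn h)
      (pow_nonneg (C.width_pos j).le n) hε
  · intro h
    refine hasAbsolutelyContinuousSpectrum_of_total (C.topologicalClosure_span_boxVec n L) ?_
    rintro f ⟨j, hj, k, hk, rfl⟩ σ ⟨hfin, hσ⟩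
    have hLj : ∀ i, j ≤ i → C.IsLacunary i := fun i hi => hL i (hj.trans hi)
    refine absolutelyContinuous_volume_of_summable ?_
    -- The coefficients are constant multiples of the `n`-th powers of the correlations, so their
    -- squares call for the exponent `2 * n`.
    have hs := (RankOneParams.summable_corr_pow hLj (k := 2 * n) (by omega)
      (RankOneParams.summable_sq_div_pow hC.columnGrowth h)).mul_left ((C.width j ^ n) ^ 2)
    refine hs.congr fun m => ?_
    rw [hσ, C.inner_boxVec hLj hk, Complex.norm_real, Real.norm_eq_abs, sq_abs]
    ring
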